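/- Independent Set Reconfiguration on $d$-degenerate graphs is fixed-parameter tractable, parameterized by $k+d$. In detail: an instance $x$ consists of a finite simple graph $G$, integers $k\ge 1$ and $d\ge 0$ such that $G$ is $d$-degenerate (every nonempty induced subgraph of $G$ has a vertex of degree at most $d$), and two independent sets $I_s, I_t$ of $G$ with $|I_s|=|I_t|=k$. The question is whether there is a sequence $I_s=I_0,I_1,\dots,I_\ell=I_t$ of independent sets of $G$, each of size $k$ or $k-1$, such that $|I_i\,\triangle\, I_{i+1}|=1$ for all $0\le i<\ell$; that is, whether $I_s$ and $I_t$ are joined by a path in the graph whose nodes are the independent sets of $G$ of size $k$ or $k-1$, two of them being adjacent when one arises from the other by adding or deleting a single vertex. Theorem. There are a single algorithm, a function $f:\mathbb N\to\mathbb N$ and a constant $c$ such that the algorithm decides every such instance $x$ correctly in at most $f(k+d)\cdot|x|^{c}$ steps, where $|x|$ is the size of the encoding of $x$ by the numbers $|V(G)|, k, d$, the characteristic vectors of $I_s$ and $I_t$, and the adjacency matrix of $G$. (Algorithms are programs of a random-access machine with addition and truncated subtraction and unit cost for each instruction and each test, a model polynomially equivalent to Turing machines.) -/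

import Mathlib

/-! ### Random-access machines with a step count -/

/-- Programs of a random-access machine in structured form.  The machine has registers and a main
memory, both indexed by `ℕ` and holding natural numbers; a program mentions only finitely many
registers, and memory is accessed indirectly, through addresses held in registers. -/
inductive RAMProgram : Type
  /-- `R i := c` -/
  | const (i c : ℕ)
  /-- `R i := R j + R l` -/
  | add (i j l : ℕ)
  /-- `R i := R j - R l`, truncated at `0` -/
  | sub (i j l : ℕ)
  /-- `R i := M (R j)` -/
  | load (i j : ℕ)
  /-- `M (R i) := R j` -/
  | store (i j : ℕ)
  /-- first `P`, then `Q` -/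
  | seq (P Q : RAMProgram)
  /-- if `R i ≠ 0` then `P` else `Q` -/
  | ite (i : ℕ) (P Q : RAMProgram)
  /-- while `R i ≠ 0` do `P` -/
  | while (i : ℕ) (P : RAMProgram)

/-- The contents of the registers and of the main memory. -/
@[ext] structure RAMState where
  reg : ℕ → ℕ
  mem : ℕ → ℕ

namespace RAMState

/-- Write `a` into register `i`. -/
def setReg (s : RAMState) (i a : ℕ) : RAMState :=
  { s with reg := Function.update s.reg i a }

/-- Write `a` into memory cell `i`. -/
def setMem (s : RAMState) (i a : ℕ) : RAMState :=
  { s with mem := Function.update s.mem i a }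

/-- The start state on input `x`: the word `x` stands in the memory cells `0, 1, …`, and all the
other cells and all registers are `0`. -/
def init (x : List ℕ) : RAMState where
  reg _ := 0
  mem i := x.getD i 0

end RAMState

/-- `RAMRuns P s t s'`: started in state `s`, the program `P` halts after exactly `t` steps, in
state `s'`.  Every elementary instruction and every test of a register is one step. -/
inductive RAMRuns : RAMProgram → RAMState → ℕ → RAMState → Prop
  | const (i c : ℕ) (s : RAMState) :
      RAMRuns (.const i c) s 1 (s.setReg i c)
  | add (i j l : ℕ) (s : RAMState) :
      RAMRuns (.add i j l) s 1 (s.setReg i (s.reg j + s.reg l))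
  | sub (i j l : ℕ) (s : RAMState) :
      RAMRuns (.sub i j l) s 1 (s.setReg i (s.reg j - s.reg l))
  | load (i j : ℕ) (s : RAMState) :
      RAMRuns (.load i j) s 1 (s.setReg i (s.mem (s.reg j)))
  | store (i j : ℕ) (s : RAMState) :
      RAMRuns (.store i j) s 1 (s.setMem (s.reg i) (s.reg j))
  | seq {P Q : RAMProgram} {s s₁ s₂ : RAMState} {t₁ t₂ : ℕ}
      (hP : RAMRuns P s t₁ s₁) (hQ : RAMRuns Q s₁ t₂ s₂) :
      RAMRuns (.seq P Q) s (t₁ + t₂) s₂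
  | ite_true {i : ℕ} {P Q : RAMProgram} {s s₁ : RAMState} {t : ℕ}
      (hi : s.reg i ≠ 0) (hP : RAMRuns P s t s₁) :
      RAMRuns (.ite i P Q) s (t + 1) s₁
  | ite_false {i : ℕ} {P Q : RAMProgram} {s s₁ : RAMState} {t : ℕ}
      (hi : s.reg i = 0) (hQ : RAMRuns Q s t s₁) :
      RAMRuns (.ite i P Q) s (t + 1) s₁
  | while_done {i : ℕ} {P : RAMProgram} {s : RAMState} (hi : s.reg i = 0) :
      RAMRuns (.while i P) s 1 s
  | while_step {i : ℕ} {P : RAMProgram} {s s₁ s₂ : RAMState} {t₁ t₂ : ℕ}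
      (hi : s.reg i ≠ 0) (hP : RAMRuns P s t₁ s₁) (hW : RAMRuns (.while i P) s₁ t₂ s₂) :
      RAMRuns (.while i P) s (t₁ + t₂ + 1) s₂

/-! ### Fixed-parameter tractability -/

/-- The size of an input word: the number of bits of its entries, with one separator for each. -/
def inputSize (x : List ℕ) : ℕ := (x.map fun a => Nat.size a + 1).sum

/-- A parameterized decision problem: its admissible instances, their encoding as input words,
their parameter, and the yes-instances. -/
structure ParameterizedProblem where
  Instance : Type
  encode : Instance → List ℕ
  param : Instance → ℕ
  IsYes : Instance → Prop

/-- A parameterized problem is fixed-parameter tractable if one program, with a function `f` and a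
constant `e`, decides every instance (register `0` holds a nonzero number in the end exactly for
the yes-instances) within `f p * m ^ e` steps, where `p` is the parameter and `m` the input size. -/
def ParameterizedProblem.IsFPT (Q : ParameterizedProblem) : Prop :=
  ∃ (P : RAMProgram) (f : ℕ → ℕ) (e : ℕ), ∀ x : Q.Instance, ∃ (t : ℕ) (s : RAMState),
    RAMRuns P (RAMState.init (Q.encode x)) t s ∧
    t ≤ f (Q.param x) * inputSize (Q.encode x) ^ e ∧
    (s.reg 0 ≠ 0 ↔ Q.IsYes x)

/-! ### Independent set reconfiguration on degenerate graphs -/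

/-- Every nonempty induced subgraph has a vertex of degree at most `d`. -/
def SimpleGraph.IsDegenerate {V : Type*} (G : SimpleGraph V) (d : ℕ) : Prop :=
  ∀ S : Set V, S.Nonempty → ∃ v : S, ((G.induce S).neighborSet v).encard ≤ d

/-- The reconfiguration graph: its nodes are the independent sets of `G` of size `k` or `k - 1`,
and two of them are adjacent if one arises from the other by adding or deleting one vertex. -/
def SimpleGraph.isReconfigurationGraph {V : Type*} [DecidableEq V] (G : SimpleGraph V) (k : ℕ) :
    SimpleGraph {I : Finset V // G.IsIndepSet (I : Set V) ∧ (I.card = k ∨ I.card + 1 = k)} where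
  Adj I J := (symmDiff I.1 J.1).card = 1
  symm := ⟨fun I J h => by rw [symmDiff_comm]; exact h⟩
  loopless := ⟨fun I h => by simp at h⟩

/-- An instance of independent set reconfiguration, with vertex set `{0, …, n - 1}`, together with
a number `d` such that the graph is `d`-degenerate. -/
structure DegenerateISRInstance where
  n : ℕ
  graph : SimpleGraph (Fin n)
  k : ℕ
  d : ℕ
  source : Finset (Fin n)
  target : Finset (Fin n)
  k_pos : 0 < k
  source_indep : graph.IsIndepSet (source : Set (Fin n))
  source_card : source.card = k
  target_indep : graph.IsIndepSet (target : Set (Fin n))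
  target_card : target.card = k
  degenerate : graph.IsDegenerate d

namespace DegenerateISRInstance

open Classical in
/-- The input word: `n`, `k`, `d`, the characteristic vectors of the two independent sets, and the
adjacency matrix of the graph, row by row. -/
noncomputable def encode (x : DegenerateISRInstance) : List ℕ :=
  [x.n, x.k, x.d]
    ++ List.ofFn (fun v : Fin x.n => if v ∈ x.source then 1 else 0)
    ++ List.ofFn (fun v : Fin x.n => if v ∈ x.target then 1 else 0)
    ++ List.ofFn (fun i : Fin (x.n * x.n) => if x.graph.Adj i.divNat i.modNat then 1 else 0)

/-- There is a path from the source to the target in the reconfiguration graph. -/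
def IsYes (x : DegenerateISRInstance) : Prop :=
  (x.graph.isReconfigurationGraph x.k).Reachable
    ⟨x.source, x.source_indep, Or.inl x.source_card⟩
    ⟨x.target, x.target_indep, Or.inl x.target_card⟩

end DegenerateISRInstance

/-- Independent set reconfiguration on `d`-degenerate graphs, parameterized by `k + d`. -/
noncomputable def degenerateISR : ParameterizedProblem where
  Instance := DegenerateISRInstance
  encode := DegenerateISRInstance.encode
  param x := x.k + x.d
  IsYes := DegenerateISRInstance.IsYes

/-! The graph is shrunk to a size bounded in terms of `k` and `d`, without changing the answer, and
the reconfiguration graph of what is left is searched exhaustively.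

Irrelevant vertices (`ReconfigReach.erase`). Let `v` lie outside source and target, and suppose that
`P` consists of at least `k` vertices outside the closed neighbourhood N[v] whose closed
neighbourhoods are pairwise disjoint outside N[v]. While a token is on `v`, the other tokens, at
most `k - 1` of them, lie outside N[v], and each blocks at most one member of `P`. So the token can
be kept on an unblocked member of `P` instead, and it can change to another member whenever the next
token to arrive would block it. Hence `v` can be deleted.

Kernel size (`card_le_kernelBound`). By degeneracy, at least one vertex in `2 * d + 1` has degree at
most `2 * d`. For each such `v`, a set `P` is chosen greedily among the low-degree vertices outside
N[v]. If no vertex can be deleted, every `P` is small, and by maximality every low-degree `w`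
outside N[v] shares with some member of `P` a closed neighbour outside N[v]. There are few such
neighbours `u`. Fixing one and repeating the argument among the vertices whose closed neighbourhoods
contain `u` builds a branching of bounded width. It has bounded depth too, because closed
neighbourhoods of low-degree vertices are small (`card_commonNeighbors_le`).

Algorithm. Up to `n` rounds of deletion tests yield a vertex set `A` of bounded size. Subsets of `A`
are coded by the binary digits of numbers below `2 ^ A.card`, and the codes of the reachable sets
are marked by closing under single steps. Everything is written in two small languages, of
expressions with bounded sums and of bounded loops, where all loops run up to the value of variable
`0`. Their compilation is proved correct once, and the running time of a fixed program is polynomial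
in that value. As it never exceeds `n + 2 ^ kernelBound k d`, the bound splits into a function of
the parameter times a power of the input size. -/

/-! ### Total correctness of machine programs with a time bound -/

/-- Started in `s`, the program `P` halts within `T` steps in a state that satisfies `Q`. -/
def RAMHalts (P : RAMProgram) (s : RAMState) (T : ℕ) (Q : RAMState → Prop) : Prop :=
  ∃ t s', RAMRuns P s t s' ∧ t ≤ T ∧ Q s'

namespace RAMHalts

variable {P P' : RAMProgram} {s : RAMState} {T T' : ℕ} {Q Q' : RAMState → Prop}

theorem mono (h : RAMHalts P s T Q) (hT : T ≤ T') (hQ : ∀ s', Q s' → Q' s') :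
    RAMHalts P s T' Q' := by
  obtain ⟨t, s', hr, ht, hq⟩ := h
  exact ⟨t, s', hr, ht.trans hT, hQ s' hq⟩

theorem const {i c : ℕ} (h : Q (s.setReg i c)) : RAMHalts (.const i c) s 1 Q :=
  ⟨1, _, .const i c s, le_rfl, h⟩

theorem add {i j l : ℕ} (h : Q (s.setReg i (s.reg j + s.reg l))) :
    RAMHalts (.add i j l) s 1 Q :=
  ⟨1, _, .add i j l s, le_rfl, h⟩

theorem sub {i j l : ℕ} (h : Q (s.setReg i (s.reg j - s.reg l))) :
    RAMHalts (.sub i j l) s 1 Q :=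
  ⟨1, _, .sub i j l s, le_rfl, h⟩

theorem load {i j : ℕ} (h : Q (s.setReg i (s.mem (s.reg j)))) : RAMHalts (.load i j) s 1 Q :=
  ⟨1, _, .load i j s, le_rfl, h⟩

theorem store {i j : ℕ} (h : Q (s.setMem (s.reg i) (s.reg j))) : RAMHalts (.store i j) s 1 Q :=
  ⟨1, _, .store i j s, le_rfl, h⟩

theorem seq (h : RAMHalts P s T Q') (h' : ∀ s', Q' s' → RAMHalts P' s' T' Q) :
    RAMHalts (.seq P P') s (T + T') Q := by
  obtain ⟨t, s₁, hr, ht, hq⟩ := h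
  obtain ⟨t', s₂, hr', ht', hq'⟩ := h' s₁ hq
  exact ⟨t + t', s₂, .seq hr hr', by omega, hq'⟩

theorem ite {i : ℕ} (h : s.reg i ≠ 0 → RAMHalts P s T Q) (h' : s.reg i = 0 → RAMHalts P' s T' Q) :
    RAMHalts (.ite i P P') s (T + T' + 1) Q := by
  by_cases hi : s.reg i = 0
  · obtain ⟨t, s₁, hr, ht, hq⟩ := h' hi
    exact ⟨t + 1, s₁, .ite_false hi hr, by omega, hq⟩
  · obtain ⟨t, s₁, hr, ht, hq⟩ := h hi
    exact ⟨t + 1, s₁, .ite_true hi hr, by omega, hq⟩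

/-- A loop whose control register counts down from `n` to `0`. -/
theorem while_countdown {i n : ℕ} {Inv : ℕ → RAMState → Prop}
    (hreg : ∀ a s, a ≤ n → Inv a s → s.reg i = n - a)
    (hstep : ∀ a s, a < n → Inv a s → RAMHalts P s T (Inv (a + 1))) (h0 : Inv 0 s) :
    RAMHalts (.while i P) s (n * (T + 1) + 1) (Inv n) := by
  suffices H : ∀ b a s, a + b = n → Inv a s →
      RAMHalts (.while i P) s (b * (T + 1) + 1) (Inv n) from H n 0 s (by simp) h0
  intro b
  induction b with
  | zero =>
    intro a s hab ha
    have : s.reg i = 0 := by rw [hreg a s (by omega) ha]; omega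
    obtain rfl : a = n := by omega
    exact ⟨1, s, .while_done this, by omega, ha⟩
  | succ b ih =>
    intro a s hab ha
    have : s.reg i ≠ 0 := by rw [hreg a s (by omega) ha]; omega
    obtain ⟨t, s₁, hr, ht, hq⟩ := hstep a s (by omega) ha
    obtain ⟨t', s₂, hr', ht', hq'⟩ := ih (a + 1) s₁ (by omega) hq
    exact ⟨t + t' + 1, s₂, .while_step this hr hr', by rw [Nat.succ_mul]; omega, hq'⟩

end RAMHalts

/-! ### Polynomial bounds -/

/-- `f` is bounded by a polynomial. -/
def PolyBounded (f : ℕ → ℕ) : Prop := ∃ C D, ∀ B, f B ≤ C * (B + 1) ^ D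

namespace PolyBounded

theorem const (c : ℕ) : PolyBounded fun _ => c := ⟨c, 0, by simp⟩

theorem id : PolyBounded fun B => B := ⟨1, 1, by simp⟩

theorem add {f g : ℕ → ℕ} (hf : PolyBounded f) (hg : PolyBounded g) :
    PolyBounded fun B => f B + g B := by
  obtain ⟨C, D, h⟩ := hf
  obtain ⟨C', D', h'⟩ := hg
  refine ⟨C + C', max D D', fun B => ?_⟩
  calc f B + g B ≤ C * (B + 1) ^ D + C' * (B + 1) ^ D' := add_le_add (h B) (h' B)
    _ ≤ C * (B + 1) ^ max D D' + C' * (B + 1) ^ max D D' := by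
      gcongr <;> simp
    _ = _ := by ring

theorem mul {f g : ℕ → ℕ} (hf : PolyBounded f) (hg : PolyBounded g) :
    PolyBounded fun B => f B * g B := by
  obtain ⟨C, D, h⟩ := hf
  obtain ⟨C', D', h'⟩ := hg
  refine ⟨C * C', D + D', fun B => ?_⟩
  calc f B * g B ≤ C * (B + 1) ^ D * (C' * (B + 1) ^ D') := Nat.mul_le_mul (h B) (h' B)
    _ = _ := by ring

end PolyBounded

/-! ### Expressions with bounded sums -/

/-- Expressions over the variables (registers) and the memory.  In `sum x e`, the variable `x` runs
over the numbers below the value of variable `0`. -/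
inductive SumExpr : Type
  | const (c : ℕ)
  | var (x : ℕ)
  | add (a b : SumExpr)
  | sub (a b : SumExpr)
  | load (a : SumExpr)
  | ite (c a b : SumExpr)
  | sum (x : ℕ) (a : SumExpr)

namespace SumExpr

/-- The value of an expression. -/
def eval (m : ℕ → ℕ) : SumExpr → (ℕ → ℕ) → ℕ
  | const c, _ => c
  | var x, ρ => ρ x
  | add a b, ρ => a.eval m ρ + b.eval m ρ
  | sub a b, ρ => a.eval m ρ - b.eval m ρ
  | load a, ρ => m (a.eval m ρ)
  | ite c a b, ρ => if c.eval m ρ ≠ 0 then a.eval m ρ else b.eval m ρ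
  | sum x a, ρ => ∑ i ∈ Finset.range (ρ 0), a.eval m (Function.update ρ x i)

/-- All variables are below `N`, and variable `0` is never bound. -/
def WellFormed (N : ℕ) : SumExpr → Prop
  | const _ => True
  | var x => x < N
  | add a b => a.WellFormed N ∧ b.WellFormed N
  | sub a b => a.WellFormed N ∧ b.WellFormed N
  | load a => a.WellFormed N
  | ite c a b => c.WellFormed N ∧ a.WellFormed N ∧ b.WellFormed N
  | sum x a => x ≠ 0 ∧ x < N ∧ a.WellFormed N

instance decidableWellFormed (N : ℕ) : (e : SumExpr) → Decidable (e.WellFormed N)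
  | const _ => inferInstanceAs (Decidable True)
  | var x => inferInstanceAs (Decidable (x < N))
  | add a b =>
    have := decidableWellFormed N a
    have := decidableWellFormed N b
    inferInstanceAs (Decidable (_ ∧ _))
  | sub a b =>
    have := decidableWellFormed N a
    have := decidableWellFormed N b
    inferInstanceAs (Decidable (_ ∧ _))
  | load a => decidableWellFormed N a
  | ite c a b =>
    have := decidableWellFormed N c
    have := decidableWellFormed N a
    have := decidableWellFormed N b
    inferInstanceAs (Decidable (_ ∧ _ ∧ _))
  | sum x a =>
    have := decidableWellFormed N a
    inferInstanceAs (Decidable (x ≠ 0 ∧ x < N ∧ _))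

/-- A bound on the time for the evaluation of an expression, if variable `0` has the value `B`. -/
def cost (B : ℕ) : SumExpr → ℕ
  | const _ => 1
  | var _ => 2
  | add a b => a.cost B + b.cost B + 1
  | sub a b => a.cost B + b.cost B + 1
  | load a => a.cost B + 1
  | ite c a b => c.cost B + a.cost B + b.cost B + 1
  | sum _ a => B * (a.cost B + 5) + 7

/-- A program that evaluates an expression into register `r`, using only the registers from `r` on,
and restoring the variables it changes. -/
def compile : SumExpr → ℕ → RAMProgram
  | const c, r => .const r c
  | var x, r => .seq (.const r 0) (.add r x r)
  | add a b, r => .seq (a.compile r) (.seq (b.compile (r + 1)) (.add r r (r + 1)))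
  | sub a b, r => .seq (a.compile r) (.seq (b.compile (r + 1)) (.sub r r (r + 1)))
  | load a, r => .seq (a.compile r) (.load r r)
  | ite c a b, r => .seq (c.compile r) (.ite r (a.compile r) (b.compile r))
  | sum x a, r =>
    -- Register `r` accumulates the sum, `r + 1` saves the outer value of `x`, `r + 2` counts the
    -- rounds that remain, and `r + 3` holds the summand and then the constants.
    .seq (.const r 0) <| .seq (.add (r + 1) x r) <| .seq (.add (r + 2) 0 r) <| .seq (.const x 0) <|
    .seq (.while (r + 2) <|
      .seq (a.compile (r + 3)) <| .seq (.add r r (r + 3)) <| .seq (.const (r + 3) 1) <|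
      .seq (.add x x (r + 3)) (.sub (r + 2) (r + 2) (r + 3))) <|
    .seq (.const (r + 3) 0) (.add x (r + 1) (r + 3))

/-- Scratch registers lie above all variables, so changing them leaves values unaffected. `0 < N` is
needed because every sum reads variable `0`. -/
theorem eval_congr {N : ℕ} {m : ℕ → ℕ} {e : SumExpr} (he : e.WellFormed N) (hN : 0 < N)
    {ρ ρ' : ℕ → ℕ} (h : ∀ i < N, ρ i = ρ' i) : e.eval m ρ = e.eval m ρ' := by
  induction e generalizing ρ ρ' with
  | const c => rfl
  | var x => exact h x he
  | add a b iha ihb => simp only [eval, iha he.1 h, ihb he.2 h]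
  | sub a b iha ihb => simp only [eval, iha he.1 h, ihb he.2 h]
  | load a ih => simp only [eval, ih he h]
  | ite c a b ihc iha ihb => simp only [eval, ihc he.1 h, iha he.2.1 h, ihb he.2.2 h]
  | sum x a ih =>
    simp only [eval, h 0 hN]
    refine Finset.sum_congr rfl fun i _ => ih he.2.2 fun j hj => ?_
    by_cases hjx : j = x <;> simp [Function.update, hjx, h j hj]

/-- The preservation of all registers below `r` serves two purposes in the induction: the variables
keep their values, and a partial result in `r` survives while the second operand is computed from `r
+ 1` on. -/
theorem halts_compile {N : ℕ} {e : SumExpr} (he : e.WellFormed N) (hN : 0 < N) {r : ℕ} (hr : N ≤ r)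
    {B : ℕ} (s : RAMState) (hB : s.reg 0 = B) :
    RAMHalts (e.compile r) s (e.cost B) fun s' =>
      s'.mem = s.mem ∧ (∀ i < r, s'.reg i = s.reg i) ∧ s'.reg r = e.eval s.mem s.reg := by
  induction e generalizing s r with
  | const c =>
    refine .const ⟨rfl, fun i hi => ?_, ?_⟩ <;> simp [RAMState.setReg, eval, Function.update]
    omega
  | var x =>
    have hx : x < N := he
    refine .seq (T := 1) (T' := 1) (.const rfl) fun s' hs' => .add ?_
    subst hs'
    refine ⟨rfl, fun i hi => ?_, ?_⟩
    · simp [RAMState.setReg, Function.update, hi.ne]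
    · simp [RAMState.setReg, Function.update, eval, show x ≠ r by omega]
  | add a b iha ihb =>
    refine RAMHalts.mono (T := a.cost B + (b.cost B + 1)) ?_ (by simp only [cost]; omega)
      fun _ h => h
    refine .seq (iha he.1 hr s hB) ?_
    rintro s₁ ⟨hm, hreg, hv⟩
    refine .seq (ihb he.2 (by omega : N ≤ r + 1) s₁ (by rw [hreg 0 (by omega), hB])) ?_
    rintro s₂ ⟨hm', hreg', hv'⟩
    refine .add ⟨hm'.trans hm, fun i hi => ?_, ?_⟩
    · simp [RAMState.setReg, hi.ne, hreg' i (by omega), hreg i hi]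
    · simp only [RAMState.setReg, Function.update_self, hreg' r (by omega), hv, hv', hm, eval]
      rw [eval_congr he.2 hN fun i hi => hreg i (by omega)]
  | sub a b iha ihb =>
    refine RAMHalts.mono (T := a.cost B + (b.cost B + 1)) ?_ (by simp only [cost]; omega)
      fun _ h => h
    refine .seq (iha he.1 hr s hB) ?_
    rintro s₁ ⟨hm, hreg, hv⟩
    refine .seq (ihb he.2 (by omega : N ≤ r + 1) s₁ (by rw [hreg 0 (by omega), hB])) ?_
    rintro s₂ ⟨hm', hreg', hv'⟩
    refine .sub ⟨hm'.trans hm, fun i hi => ?_, ?_⟩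
    · simp [RAMState.setReg, hi.ne, hreg' i (by omega), hreg i hi]
    · simp only [RAMState.setReg, Function.update_self, hreg' r (by omega), hv, hv', hm, eval]
      rw [eval_congr he.2 hN fun i hi => hreg i (by omega)]
  | load a ih =>
    refine .seq (ih he hr s hB) ?_
    rintro s₁ ⟨hm, hreg, hv⟩
    refine .load ⟨hm, fun i hi => ?_, ?_⟩
    · simp [RAMState.setReg, hi.ne, hreg i hi]
    · simp [RAMState.setReg, hm, hv, eval]
  | ite c a b ihc iha ihb =>
    refine RAMHalts.mono (T := c.cost B + (a.cost B + b.cost B + 1)) ?_ (by simp only [cost]; omega)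
      fun _ h => h
    refine .seq (ihc he.1 hr s hB) ?_
    rintro s₁ ⟨hm, hreg, hv⟩
    have hB' : s₁.reg 0 = B := by rw [hreg 0 (by omega), hB]
    refine .ite (fun h => (iha he.2.1 hr s₁ hB').mono le_rfl ?_)
      (fun h => (ihb he.2.2 hr s₁ hB').mono le_rfl ?_) <;>
    rintro s₂ ⟨hm', hreg', hv'⟩ <;>
    refine ⟨hm'.trans hm, fun i hi => (hreg' i hi).trans (hreg i hi), ?_⟩ <;>
    rw [hv] at h
    · rw [hv', hm, eval_congr he.2.1 hN fun i hi => hreg i (by omega), eval, if_pos h]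
    · rw [hv', hm, eval_congr he.2.2 hN fun i hi => hreg i (by omega), eval, if_neg (by simpa)]
  | sum x a ih =>
    obtain ⟨hx0, hxN, ha⟩ := he
    -- Four initial instructions; `B` rounds, each with the summand, four instructions and a test;
    -- the final test; two instructions that restore `x`.
    refine RAMHalts.mono (T := 1 + (1 + (1 + (1 + ((B * (a.cost B + (1 + (1 + (1 + 1))) + 1) + 1)
      + (1 + 1)))))) ?_ (by simp only [cost]; nlinarith) fun _ h => h
    refine .seq (Q' := fun s' => s' = _) (.const rfl) ?_
    rintro _ rfl
    refine .seq (Q' := fun s' => s' = _) (.add rfl) ?_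
    rintro _ rfl
    refine .seq (Q' := fun s' => s' = _) (.add rfl) ?_
    rintro _ rfl
    refine .seq (Q' := fun s' => s' = _) (.const rfl) ?_
    rintro _ rfl
    let Inv : ℕ → RAMState → Prop := fun j s' => s'.mem = s.mem ∧
      (∀ i < r, i ≠ x → s'.reg i = s.reg i) ∧ s'.reg x = j ∧ s'.reg (r + 1) = s.reg x ∧
      s'.reg (r + 2) = B - j ∧
      s'.reg r = ∑ i ∈ Finset.range j, a.eval s.mem (Function.update s.reg x i)
    refine .seq (RAMHalts.while_countdown (n := B) (Inv := Inv) (fun _ _ _ h => h.2.2.2.2.1)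
      ?_ ?_) ?_
    · rintro j s₁ hj ⟨hm, hreg, hx, hsave, hcount, hacc⟩
      refine .seq (ih ha (by omega : N ≤ r + 3) s₁ (by rw [hreg 0 (by omega) hx0.symm, hB])) ?_
      rintro s₂ ⟨hm', hreg', hv⟩
      change RAMHalts _ _ (1 + (1 + (1 + 1))) _
      refine .seq (Q' := fun s' => s' = _) (.add rfl) ?_
      rintro _ rfl
      refine .seq (Q' := fun s' => s' = _) (.const rfl) ?_
      rintro _ rfl
      refine .seq (Q' := fun s' => s' = _) (.add rfl) ?_
      rintro _ rfl
      refine .sub ⟨hm'.trans hm, fun i hi hix => ?_, ?_, ?_, ?_, ?_⟩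
      · simp [RAMState.setReg, Function.update, hix, show i ≠ r + 2 by omega,
          show i ≠ r + 3 by omega, hi.ne, hreg' i (by omega), hreg i hi hix]
      · simp [RAMState.setReg, Function.update, show x ≠ r + 2 by omega,
          show x ≠ r + 3 by omega, show x ≠ r by omega, hreg' x (by omega), hx]
      · simp [RAMState.setReg, Function.update, show r + 1 ≠ x by omega, hreg' (r + 1) (by omega),
          hsave]
      · simp [RAMState.setReg, Function.update, show r + 2 ≠ x by omega, show r + 3 ≠ x by omega,
          hreg' (r + 2) (by omega), hcount]
        omega
      · have : a.eval s₁.mem s₁.reg = a.eval s.mem (Function.update s.reg x j) := by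
          rw [hm]
          refine eval_congr ha hN fun i hi => ?_
          by_cases hix : i = x
          · simp [hix, hx]
          · simp [hix, hreg i (by omega) hix]
        simp [RAMState.setReg, Function.update, show r ≠ x by omega, hreg' r (by omega), hacc, hv,
          this, Finset.sum_range_succ]
    · refine ⟨rfl, fun i hi hix => ?_, ?_, ?_, ?_, ?_⟩
      · simp [RAMState.setReg, Function.update, hix, show i ≠ r + 2 by omega,
          show i ≠ r + 1 by omega, hi.ne]
      · simp [RAMState.setReg]
      · simp [RAMState.setReg, Function.update, show r + 1 ≠ x by omega, show x ≠ r by omega]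
      · simp [RAMState.setReg, Function.update, show r + 2 ≠ x by omega, show 0 ≠ r by omega, hB]
      · simp [RAMState.setReg, Function.update, show r ≠ x by omega]
    · rintro s₁ ⟨hm, hreg, hx, hsave, hcount, hacc⟩
      refine .seq (Q' := fun s' => s' = _) (.const rfl) ?_
      rintro _ rfl
      refine .add ⟨hm, fun i hi => ?_, ?_⟩
      · by_cases hix : i = x
        · simp [RAMState.setReg, hix, hsave]
        · simp [RAMState.setReg, Function.update, hix, hreg i hi hix, show i ≠ r + 3 by omega]
      · simp [RAMState.setReg, Function.update, show r ≠ x by omega, hacc, eval, hB]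

/-- Each nested sum contributes one factor `B`, and the nesting depth of a fixed expression is
constant. -/
theorem polyBounded_cost (e : SumExpr) : PolyBounded fun B => e.cost B := by
  induction e with
  | const c => exact .const 1
  | var x => exact .const 2
  | add a b iha ihb => exact (iha.add ihb).add (.const 1)
  | sub a b iha ihb => exact (iha.add ihb).add (.const 1)
  | load a ih => exact ih.add (.const 1)
  | ite c a b ihc iha ihb => exact ((ihc.add iha).add ihb).add (.const 1)
  | sum x a ih => exact (PolyBounded.id.mul (ih.add (.const 5))).add (.const 7)

/-- A program that assigns the value of an expression to the variable `x`, using only the registers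
from `r` on. -/
def assign (x : ℕ) (e : SumExpr) (r : ℕ) : RAMProgram :=
  .seq (e.compile r) (.seq (.const (r + 1) 0) (.add x r (r + 1)))

theorem halts_assign {N : ℕ} {e : SumExpr} (he : e.WellFormed N) (hN : 0 < N) {r : ℕ} (hr : N ≤ r)
    {x : ℕ} {B : ℕ} (s : RAMState) (hB : s.reg 0 = B) :
    RAMHalts (assign x e r) s (e.cost B + 2) fun s' =>
      s'.mem = s.mem ∧ ∀ i < r, s'.reg i = Function.update s.reg x (e.eval s.mem s.reg) i := by
  refine .seq (T' := 1 + 1) (halts_compile he hN hr s hB) ?_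
  rintro s₁ ⟨hm, hreg, hv⟩
  refine .seq (Q' := fun s' => s' = _) (.const rfl) ?_
  rintro _ rfl
  refine .add ⟨hm, fun i hi => ?_⟩
  by_cases hix : i = x
  · simp [RAMState.setReg, hix, hv]
  · simp [RAMState.setReg, Function.update, hix, hreg i hi, show i ≠ r + 1 by omega]

end SumExpr

/-! ### Bounded loops -/

/-- Programs of assignments to memory cells and of loops.  In `loop x P`, the variable `x`
runs over the numbers below the value of variable `0`. -/
inductive LoopProgram : Type
  | store (a b : SumExpr)
  | seq (P Q : LoopProgram)
  | loop (x : ℕ) (P : LoopProgram)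

namespace LoopProgram

/-- The memory after a run of the program. -/
def exec : LoopProgram → (ℕ → ℕ) → (ℕ → ℕ) → ℕ → ℕ
  | store a b, ρ, m => Function.update m (a.eval m ρ) (b.eval m ρ)
  | seq P Q, ρ, m => Q.exec ρ (P.exec ρ m)
  | loop x P, ρ, m =>
    Nat.rec m (fun i m' => P.exec (Function.update ρ x i) m') (ρ 0)

/-- All variables are below `N`, and variable `0` is never bound. -/
def WellFormed (N : ℕ) : LoopProgram → Prop
  | store a b => a.WellFormed N ∧ b.WellFormed N
  | seq P Q => P.WellFormed N ∧ Q.WellFormed N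
  | loop x P => x ≠ 0 ∧ x < N ∧ P.WellFormed N

instance decidableWellFormed (N : ℕ) : (P : LoopProgram) → Decidable (P.WellFormed N)
  | store a b => inferInstanceAs (Decidable (a.WellFormed N ∧ b.WellFormed N))
  | seq P Q =>
    have := decidableWellFormed N P
    have := decidableWellFormed N Q
    inferInstanceAs (Decidable (_ ∧ _))
  | loop x P =>
    have := decidableWellFormed N P
    inferInstanceAs (Decidable (x ≠ 0 ∧ x < N ∧ _))

/-- A bound on the running time, if variable `0` has the value `B`. -/
def cost (B : ℕ) : LoopProgram → ℕ
  | store a b => a.cost B + b.cost B + 1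
  | seq P Q => P.cost B + Q.cost B
  | loop _ P => B * (P.cost B + 6) + 7

/-- The machine program, using only the registers from `r` on and the loop variables. -/
def compile : LoopProgram → ℕ → RAMProgram
  | store a b, r => .seq (a.compile r) (.seq (b.compile (r + 1)) (.store r (r + 1)))
  | seq P Q, r => .seq (P.compile r) (Q.compile r)
  | loop x P, r =>
    .seq (.const r 0) <| .seq (.add (r + 1) x r) <| .seq (.add (r + 2) 0 r) <| .seq (.const x 0) <|
    .seq (.while (r + 2) <|
      .seq (P.compile (r + 3)) <| .seq (.const (r + 3) 1) <|
      .seq (.add x x (r + 3)) (.sub (r + 2) (r + 2) (r + 3))) <|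
    .seq (.const (r + 3) 0) (.add x (r + 1) (r + 3))

theorem exec_congr {N : ℕ} {P : LoopProgram} (hP : P.WellFormed N) (hN : 0 < N) {m : ℕ → ℕ}
    {ρ ρ' : ℕ → ℕ} (h : ∀ i < N, ρ i = ρ' i) : P.exec ρ m = P.exec ρ' m := by
  induction P generalizing ρ ρ' m with
  | store a b => simp only [exec, SumExpr.eval_congr hP.1 hN h, SumExpr.eval_congr hP.2 hN h]
  | seq P Q ihP ihQ => simp only [exec, ihP hP.1 h, ihQ hP.2 h]
  | loop x P ih =>
    simp only [exec, h 0 hN]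
    congr 1
    funext i m'
    refine ih hP.2.2 fun j hj => ?_
    by_cases hjx : j = x <;> simp [Function.update, hjx, h j hj]

theorem halts_compile {N : ℕ} {P : LoopProgram} (hP : P.WellFormed N) (hN : 0 < N) {r : ℕ}
    (hr : N ≤ r) {B : ℕ} (s : RAMState) (hB : s.reg 0 = B) :
    RAMHalts (P.compile r) s (P.cost B) fun s' =>
      s'.mem = P.exec s.reg s.mem ∧ ∀ i < r, s'.reg i = s.reg i := by
  induction P generalizing s r with
  | store a b =>
    refine RAMHalts.mono (T := a.cost B + (b.cost B + 1)) ?_ (by simp only [cost]; omega)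
      fun _ h => h
    refine .seq (a.halts_compile hP.1 hN hr s hB) ?_
    rintro s₁ ⟨hm, hreg, hv⟩
    refine .seq (b.halts_compile hP.2 hN (by omega : N ≤ r + 1) s₁
      (by rw [hreg 0 (by omega), hB])) ?_
    rintro s₂ ⟨hm', hreg', hv'⟩
    refine .store ⟨?_, fun i hi => ?_⟩
    · simp only [RAMState.setMem, hm', hm, hreg' r (by omega), hv, hv', exec]
      rw [SumExpr.eval_congr hP.2 hN fun i hi => hreg i (by omega)]
    · simp [RAMState.setMem, hreg' i (by omega), hreg i hi]
  | seq P Q ihP ihQ =>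
    refine .seq (ihP hP.1 hr s hB) ?_
    rintro s₁ ⟨hm, hreg⟩
    refine (ihQ hP.2 hr s₁ (by rw [hreg 0 (by omega), hB])).mono le_rfl ?_
    rintro s₂ ⟨hm', hreg'⟩
    refine ⟨?_, fun i hi => (hreg' i hi).trans (hreg i hi)⟩
    rw [hm', hm, exec, exec_congr hP.2 hN fun i hi => hreg i (by omega)]
  | loop x P ih =>
    obtain ⟨hx0, hxN, ha⟩ := hP
    refine RAMHalts.mono (T := 1 + (1 + (1 + (1 + ((B * (P.cost B + (1 + (1 + 1)) + 1) + 1)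
      + (1 + 1)))))) ?_ (by simp only [cost]; nlinarith) fun _ h => h
    refine .seq (Q' := fun s' => s' = _) (.const rfl) ?_
    rintro _ rfl
    refine .seq (Q' := fun s' => s' = _) (.add rfl) ?_
    rintro _ rfl
    refine .seq (Q' := fun s' => s' = _) (.add rfl) ?_
    rintro _ rfl
    refine .seq (Q' := fun s' => s' = _) (.const rfl) ?_
    rintro _ rfl
    let Inv : ℕ → RAMState → Prop := fun j s' =>
      s'.mem = Nat.rec s.mem (fun i m' => P.exec (Function.update s.reg x i) m') j ∧
      (∀ i < r, i ≠ x → s'.reg i = s.reg i) ∧ s'.reg x = j ∧ s'.reg (r + 1) = s.reg x ∧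
      s'.reg (r + 2) = B - j
    refine .seq (RAMHalts.while_countdown (n := B) (Inv := Inv) (fun _ _ _ h => h.2.2.2.2)
      ?_ ?_) ?_
    · rintro j s₁ hj ⟨hm, hreg, hx, hsave, hcount⟩
      refine .seq (ih ha (by omega : N ≤ r + 3) s₁ (by rw [hreg 0 (by omega) hx0.symm, hB])) ?_
      rintro s₂ ⟨hm', hreg'⟩
      change RAMHalts _ _ (1 + (1 + 1)) _
      refine .seq (Q' := fun s' => s' = _) (.const rfl) ?_
      rintro _ rfl
      refine .seq (Q' := fun s' => s' = _) (.add rfl) ?_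
      rintro _ rfl
      refine .sub ⟨?_, fun i hi hix => ?_, ?_, ?_, ?_⟩
      · refine hm'.trans ?_
        rw [hm]
        refine exec_congr ha hN fun i hi => ?_
        by_cases hix : i = x
        · simp [hix, hx]
        · simp [hix, hreg i (by omega) hix]
      · simp [RAMState.setReg, Function.update, hix, show i ≠ r + 2 by omega,
          show i ≠ r + 3 by omega, hreg' i (by omega), hreg i hi hix]
      · simp [RAMState.setReg, Function.update, show x ≠ r + 2 by omega,
          show x ≠ r + 3 by omega, hreg' x (by omega), hx]
      · simp [RAMState.setReg, Function.update, show r + 1 ≠ x by omega, hreg' (r + 1) (by omega),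
          hsave]
      · simp [RAMState.setReg, Function.update, show r + 2 ≠ x by omega, show r + 3 ≠ x by omega,
          hreg' (r + 2) (by omega), hcount]
        omega
    · refine ⟨rfl, fun i hi hix => ?_, ?_, ?_, ?_⟩
      · simp [RAMState.setReg, Function.update, hix, show i ≠ r + 2 by omega,
          show i ≠ r + 1 by omega, hi.ne]
      · simp [RAMState.setReg]
      · simp [RAMState.setReg, Function.update, show r + 1 ≠ x by omega, show x ≠ r by omega]
      · simp [RAMState.setReg, Function.update, show r + 2 ≠ x by omega, show 0 ≠ r by omega, hB]
    · rintro s₁ ⟨hm, hreg, hx, hsave, hcount⟩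
      refine .seq (Q' := fun s' => s' = _) (.const rfl) ?_
      rintro _ rfl
      refine .add ⟨?_, fun i hi => ?_⟩
      · rw [exec, hB]; exact hm
      · by_cases hix : i = x
        · simp [RAMState.setReg, hix, hsave]
        · simp [RAMState.setReg, Function.update, hix, hreg i hi hix, show i ≠ r + 3 by omega]

theorem polyBounded_cost (P : LoopProgram) : PolyBounded fun B => P.cost B := by
  induction P with
  | store a b => exact (a.polyBounded_cost.add b.polyBounded_cost).add (.const 1)
  | seq P Q ihP ihQ => exact ihP.add ihQ
  | loop x P ih => exact (PolyBounded.id.mul (ih.add (.const 6))).add (.const 7)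

end LoopProgram

/-! ### Reconfiguration within a set of vertices -/

namespace SimpleGraph

section ClosedNeighborhood

variable {V : Type*} (G : SimpleGraph V)

/-- `u` lies in the closed neighbourhood of `v`. -/
def ClosedAdj (u v : V) : Prop := u = v ∨ G.Adj u v

variable {G}

theorem ClosedAdj.symm {u v : V} (h : G.ClosedAdj u v) : G.ClosedAdj v u :=
  h.imp Eq.symm (fun h => h.symm)

/-- Few vertices outside the closed neighbourhood of `v` cannot dominate a large set of vertices with
disjoint closed neighbourhoods. -/
theorem exists_undominated {A P X : Finset V} {v : V} (hXA : X ⊆ A)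
    (hdisj : ∀ w ∈ P, ∀ w' ∈ P, ∀ u ∈ A, ¬ G.ClosedAdj u v → G.ClosedAdj u w →
      G.ClosedAdj u w' → w = w')
    (hXv : ∀ x ∈ X, ¬ G.ClosedAdj x v) (hcard : X.card < P.card) :
    ∃ w ∈ P, ∀ x ∈ X, ¬ G.ClosedAdj x w := by
  by_contra! hcon
  choose! f hfX hf using hcon
  refine hcard.not_ge (Finset.card_le_card_of_injOn f hfX fun w hw w' hw' h => ?_)
  exact hdisj w hw w' hw' (f w) (hXA (hfX w hw)) (hXv _ (hfX w hw)) (hf w hw) (h ▸ hf w' hw')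

end ClosedNeighborhood

section Reconfiguration

variable {V : Type*} [DecidableEq V] (G : SimpleGraph V)

/-- `I` is an independent set of size `k` or `k - 1` within `A`. -/
def IsReconfigNode (k : ℕ) (A I : Finset V) : Prop :=
  I ⊆ A ∧ G.IsIndepSet (I : Set V) ∧ (I.card = k ∨ I.card + 1 = k)

/-- `J` arises from `I` by adding or deleting one vertex, within the independent sets of size `k` or
`k - 1` contained in `A`. -/
def ReconfigStep (k : ℕ) (A I J : Finset V) : Prop :=
  G.IsReconfigNode k A I ∧ G.IsReconfigNode k A J ∧ (symmDiff I J).card = 1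

/-- `J` arises from `I` by a sequence of additions and deletions of vertices. -/
def ReconfigReach (k : ℕ) (A : Finset V) : Finset V → Finset V → Prop :=
  Relation.ReflTransGen (G.ReconfigStep k A)

variable {G}

theorem isIndepSet_insert_iff {I : Finset V} {u : V} (hu : u ∉ I) :
    G.IsIndepSet (insert u I : Finset V) ↔
      G.IsIndepSet (I : Set V) ∧ ∀ x ∈ I, ¬ G.ClosedAdj x u := by
  have : Std.Symm fun v w => ¬ G.Adj v w := ⟨fun a b h h' => h h'.symm⟩
  rw [Finset.coe_insert, IsIndepSet, Set.pairwise_insert_of_symm_of_notMem (by simpa)]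
  refine and_congr_right fun _ => forall₂_congr fun x hx => ?_
  have : x ≠ u := fun h => hu (h ▸ hx)
  simp [ClosedAdj, this, G.adj_comm u x]

theorem card_symmDiff_eq_one {I J : Finset V} (h : (symmDiff I J).card = 1) :
    ∃ u, (u ∉ I ∧ J = insert u I) ∨ (u ∉ J ∧ I = insert u J) := by
  obtain ⟨u, hu⟩ := Finset.card_eq_one.mp h
  have key : ∀ x, (x ∈ I ∧ x ∉ J ∨ x ∈ J ∧ x ∉ I) ↔ x = u := by
    intro x; rw [← Finset.mem_symmDiff, hu, Finset.mem_singleton]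
  refine ⟨u, ?_⟩
  by_cases huI : u ∈ I
  · have := (key u).2 rfl
    refine .inr ⟨by tauto, ?_⟩
    ext x
    have := key x
    rw [Finset.mem_insert]
    by_cases hx : x = u
    · simp [hx, huI]
    · tauto
  · refine .inl ⟨huI, ?_⟩
    have := (key u).2 rfl
    ext x
    have := key x
    rw [Finset.mem_insert]
    by_cases hx : x = u
    · subst hx; tauto
    · tauto

theorem card_symmDiff_insert {I : Finset V} {u : V} (hu : u ∉ I) :
    (symmDiff I (insert u I)).card = 1 := by
  refine Finset.card_eq_one.mpr ⟨u, ?_⟩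
  ext x
  rw [Finset.mem_symmDiff, Finset.mem_insert, Finset.mem_singleton]
  by_cases hx : x = u
  · subst hx; tauto
  · tauto

theorem IsReconfigNode.insert_mem {k : ℕ} {A I : Finset V} {u : V} (hu : ∀ x ∈ I, ¬ G.ClosedAdj x u)
    (h : G.IsReconfigNode k A I) (hk : I.card + 1 = k) (huA : u ∈ A) :
    G.IsReconfigNode k A (insert u I) := by
  have huI : u ∉ I := fun h => hu u h (.inl rfl)
  refine ⟨Finset.insert_subset huA h.1, (isIndepSet_insert_iff huI).2 ⟨h.2.1, hu⟩, .inl ?_⟩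
  rw [Finset.card_insert_of_notMem huI, hk]

theorem ReconfigStep.symm {k : ℕ} {A I J : Finset V} (h : G.ReconfigStep k A I J) :
    G.ReconfigStep k A J I :=
  ⟨h.2.1, h.1, by rw [symmDiff_comm]; exact h.2.2⟩

theorem IsReconfigNode.step_insert {k : ℕ} {A I : Finset V} {u : V}
    (hu : ∀ x ∈ I, ¬ G.ClosedAdj x u) (h : G.IsReconfigNode k A I) (hk : I.card + 1 = k)
    (huA : u ∈ A) : G.ReconfigStep k A I (insert u I) :=
  ⟨h, h.insert_mem hu hk huA, card_symmDiff_insert fun h => hu u h (.inl rfl)⟩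

theorem ReconfigReach.mono {k : ℕ} {A B I J : Finset V} (hAB : A ⊆ B)
    (h : G.ReconfigReach k A I J) : G.ReconfigReach k B I J :=
  Relation.ReflTransGen.mono
    (fun _ _ h => ⟨⟨h.1.1.trans hAB, h.1.2⟩, ⟨h.2.1.1.trans hAB, h.2.1.2⟩, h.2.2⟩) _ _ h

/-- A vertex `v` is irrelevant for reconfiguration if there are `k` vertices outside its closed
neighbourhood such that no vertex outside the closed neighbourhood of `v` is in the closed
neighbourhoods of two of them. -/
theorem ReconfigReach.erase {k : ℕ} {A S T P : Finset V} {v : V} (hPA : P ⊆ A)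
    (hPv : ∀ w ∈ P, ¬ G.ClosedAdj w v)
    (hdisj : ∀ w ∈ P, ∀ w' ∈ P, ∀ u ∈ A, ¬ G.ClosedAdj u v → G.ClosedAdj u w →
      G.ClosedAdj u w' → w = w')
    (hk : k ≤ P.card) (hS : v ∉ S) (hT : v ∉ T) (h : G.ReconfigReach k A S T) :
    G.ReconfigReach k (A.erase v) S T := by
  have hPne : ∀ w ∈ P, w ≠ v := fun w hw h => hPv w hw (.inl h)
  have node_of_notMem : ∀ {I}, v ∉ I → G.IsReconfigNode k A I →
      G.IsReconfigNode k (A.erase v) I := fun hv h =>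
    ⟨fun x hx => Finset.mem_erase.2 ⟨fun e => hv (e ▸ hx), h.1 hx⟩, h.2⟩
  -- The simulation: a set avoiding `v` is reached as it is; a set `insert v K` is represented by
  -- `insert w K`, where `w ∈ P` is not blocked by `K`.
  suffices H : ∀ I, G.ReconfigReach k A S I → (v ∉ I → G.ReconfigReach k (A.erase v) S I) ∧
      ∀ K, v ∉ K → I = insert v K → ∃ w ∈ P, (∀ x ∈ K, ¬ G.ClosedAdj x w) ∧
        G.ReconfigReach k (A.erase v) S (insert w K) from (H T h).1 hT
  intro I hI
  induction hI with
  | refl =>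
    refine ⟨fun _ => .refl, ?_⟩
    rintro K - rfl
    simp at hS
  | @tail I J hI hIJ ih =>
    obtain ⟨ih₁, ih₂⟩ := ih
    obtain ⟨nI, nJ, hone⟩ := hIJ
    obtain ⟨u, ⟨huI, rfl⟩ | ⟨huJ, rfl⟩⟩ := card_symmDiff_eq_one hone
    · have hIk : I.card + 1 = k := by
        have h1 := nJ.2.2
        have h2 := nI.2.2
        rw [Finset.card_insert_of_notMem huI] at h1
        omega
      have huadj := ((isIndepSet_insert_iff huI).1 nJ.2.1).2
      refine ⟨fun hv => ?_, fun K hvK hK => ?_⟩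
      · exact (ih₁ fun h => hv (Finset.mem_insert_of_mem h)).tail
          ⟨node_of_notMem (fun h => hv (Finset.mem_insert_of_mem h)) nI, node_of_notMem hv nJ, hone⟩
      by_cases huv : u = v
      -- The token arrives on `v`; it is put on an unblocked `w` instead. The other tokens number `k
      -- - 1`, so one exists.
      · subst huv
        obtain rfl : I = K := by
          rw [← Finset.erase_insert huI, hK, Finset.erase_insert hvK]
        obtain ⟨w, hwP, hw⟩ := exists_undominated nI.1 hdisj huadj (by omega)
        exact ⟨w, hwP, hw, (ih₁ huI).tail
          ((node_of_notMem huI nI).step_insert hw hIk (Finset.mem_erase.2 ⟨hPne w hwP, hPA hwP⟩))⟩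
      -- Another token `u` arrives while `v` is occupied. With `I = insert v M`, the current
      -- representative is `insert w M`.
      · have hvI : v ∈ I := by
          have : v ∈ insert u I := hK ▸ Finset.mem_insert_self v K
          exact Finset.mem_of_mem_insert_of_ne this (Ne.symm huv)
        obtain ⟨M, hvM, rfl⟩ : ∃ M, v ∉ M ∧ I = insert v M :=
          ⟨I.erase v, Finset.notMem_erase _ _, (Finset.insert_erase hvI).symm⟩
        obtain rfl : K = insert u M := by
          rw [← Finset.erase_insert hvK, ← hK, Finset.insert_comm, Finset.erase_insert]
          simp [Ne.symm huv, hvM]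
        obtain ⟨w, hwP, hw, hreach⟩ := ih₂ M hvM rfl
        have huM : u ∉ M := fun h => huI (Finset.mem_insert_of_mem h)
        have huMadj : ∀ x ∈ M, ¬ G.ClosedAdj x u := fun x hx =>
          huadj x (Finset.mem_insert_of_mem hx)
        have huv' : ¬ G.ClosedAdj u v := fun h => huadj v (Finset.mem_insert_self _ _) h.symm
        have huA : u ∈ A := nJ.1 (Finset.mem_insert_self _ _)
        have hMA : M ⊆ A := (Finset.subset_insert _ _).trans nI.1
        have hMi : G.IsIndepSet (M : Set V) := ((isIndepSet_insert_iff hvM).1 nI.2.1).1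
        have hMv := ((isIndepSet_insert_iff hvM).1 nI.2.1).2
        have hMk : M.card + 2 = k := by
          rw [Finset.card_insert_of_notMem hvM] at hIk; omega
        have hMA' : M ⊆ A.erase v := fun x hx =>
          Finset.mem_erase.2 ⟨fun e => hvM (e ▸ hx), hMA hx⟩
        have huA' : u ∈ A.erase v := Finset.mem_erase.2 ⟨huv, huA⟩
        have hmem : ∀ {w}, w ∈ P → w ∈ A.erase v := fun h =>
          Finset.mem_erase.2 ⟨hPne _ h, hPA h⟩
        have node : ∀ {w}, w ∈ P → (∀ x ∈ M, ¬ G.ClosedAdj x w) →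
            G.IsReconfigNode k (A.erase v) (insert w M) := by
          intro w hwP hw
          have hwM : w ∉ M := fun h => hw w h (.inl rfl)
          refine ⟨Finset.insert_subset (hmem hwP) hMA',
            (isIndepSet_insert_iff hwM).2 ⟨hMi, hw⟩, .inr ?_⟩
          rw [Finset.card_insert_of_notMem hwM]; omega
        have card : ∀ {w}, (∀ x ∈ M, ¬ G.ClosedAdj x w) → (insert w M).card + 1 = k := by
          intro w hw
          rw [Finset.card_insert_of_notMem fun h => hw w h (.inl rfl)]; omega
        have final : ∀ {w}, w ∈ P → (∀ x ∈ insert u M, ¬ G.ClosedAdj x w) →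
            G.ReconfigStep k (A.erase v) (insert w M) (insert w (insert u M)) := by
          intro w hwP hw
          have hw' : ∀ x ∈ M, ¬ G.ClosedAdj x w := fun x hx => hw x (Finset.mem_insert_of_mem hx)
          rw [Finset.insert_comm]
          refine (node hwP hw').step_insert ?_ (card hw') huA'
          intro x hx
          obtain rfl | hx := Finset.mem_insert.1 hx
          · exact fun h => hw u (Finset.mem_insert_self _ _) h.symm
          · exact huMadj x hx
        by_cases huw : G.ClosedAdj u w
        -- Here `u` would block `w`. The set `insert u M` has `k - 1` elements outside N[v], so it
        -- leaves some `w'` unblocked.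
        · obtain ⟨w', hwP', hw'⟩ := exists_undominated (X := insert u M)
            (Finset.insert_subset huA hMA) hdisj (by
              intro x hx
              obtain rfl | hx := Finset.mem_insert.1 hx
              · exact huv'
              · exact hMv x hx) (by rw [Finset.card_insert_of_notMem huM]; omega)
          have hww' : w ≠ w' := fun h => hw' u (Finset.mem_insert_self _ _) (h ▸ huw)
          have hww'' : ¬ G.ClosedAdj w w' := fun h =>
            hww' (hdisj w hwP w' hwP' w (hPA hwP) (hPv w hwP) (.inl rfl) h)
          have hwM' : ∀ x ∈ M, ¬ G.ClosedAdj x w' := fun x hx =>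
            hw' x (Finset.mem_insert_of_mem hx)
          -- Add `w'`, remove `w`, add `u`: the sizes are `k`, `k - 1`, `k`. The vertices `w` and
          -- `w'` are not adjacent, since `w` itself would lie in both closed neighbourhoods.
          refine ⟨w', hwP', hw', .tail (.tail (.tail (c := insert w' (insert w M)) hreach ?_)
            (.symm ?_)) (final hwP' hw')⟩
          · refine (node hwP hw).step_insert ?_ (card hw) (hmem hwP')
            intro x hx
            obtain rfl | hx := Finset.mem_insert.1 hx
            · exact hww''
            · exact hwM' x hx
          · rw [Finset.insert_comm]
            refine (node hwP' hwM').step_insert ?_ (card hwM') (hmem hwP)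
            intro x hx
            obtain rfl | hx := Finset.mem_insert.1 hx
            · exact fun h => hww'' h.symm
            · exact hw x hx
        · have hw' : ∀ x ∈ insert u M, ¬ G.ClosedAdj x w := by
            intro x hx
            obtain rfl | hx := Finset.mem_insert.1 hx
            · exact huw
            · exact hw x hx
          exact ⟨w, hwP, hw', hreach.tail (final hwP hw')⟩
    · have hJk : J.card + 1 = k := by
        have h1 := nJ.2.2
        have h2 := nI.2.2
        rw [Finset.card_insert_of_notMem huJ] at h2
        omega
      refine ⟨fun hv => ?_, fun K hvK hK => ?_⟩
      -- If the token on `v` leaves, its substitute `w` is removed.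
      · by_cases huv : u = v
        · subst huv
          obtain ⟨w, hwP, hw, hreach⟩ := ih₂ J hv rfl
          exact hreach.tail ((node_of_notMem hv nJ).step_insert hw hJk
            (Finset.mem_erase.2 ⟨hPne w hwP, hPA hwP⟩)).symm
        · have hvI : v ∉ insert u J := by simp [hv, Ne.symm huv]
          exact (ih₁ hvI).tail ⟨node_of_notMem hvI nI, node_of_notMem hv nJ, hone⟩
      · subst hK
        have huv : u ≠ v := fun h => huJ (h ▸ Finset.mem_insert_self _ _)
        have huK : u ∉ K := fun h => huJ (Finset.mem_insert_of_mem h)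
        -- The token on `v` stays and `u` leaves, so the same `w` remains unblocked.
        obtain ⟨w, hwP, hw, hreach⟩ := ih₂ (insert u K) (by simp [hvK, Ne.symm huv])
          (Finset.insert_comm _ _ _)
        have hw' : ∀ x ∈ K, ¬ G.ClosedAdj x w := fun x hx => hw x (Finset.mem_insert_of_mem hx)
        have hwK : w ∉ K := fun h => hw' w h (.inl rfl)
        have hwA : w ∈ A.erase v := Finset.mem_erase.2 ⟨hPne w hwP, hPA hwP⟩
        refine ⟨w, hwP, hw', hreach.tail (.symm ?_)⟩
        rw [Finset.insert_comm]
        refine IsReconfigNode.step_insert ?_ ⟨?_, ?_, ?_⟩ ?_ ?_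
        · intro x hx
          obtain rfl | hx := Finset.mem_insert.1 hx
          · exact fun h => hw u (Finset.mem_insert_self _ _) h.symm
          · exact ((isIndepSet_insert_iff huJ).1 nI.2.1).2 x (Finset.mem_insert_of_mem hx)
        · refine Finset.insert_subset hwA fun x hx => Finset.mem_erase.2 ⟨fun e => hvK (e ▸ hx), ?_⟩
          exact nJ.1 (Finset.mem_insert_of_mem hx)
        · exact (isIndepSet_insert_iff hwK).2 ⟨((isIndepSet_insert_iff hvK).1 nJ.2.1).1, hw'⟩
        · rw [Finset.card_insert_of_notMem hvK] at hJk
          rw [Finset.card_insert_of_notMem hwK]; omega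
        · rw [Finset.card_insert_of_notMem hvK] at hJk
          rw [Finset.card_insert_of_notMem hwK]; omega
        · exact Finset.mem_erase.2 ⟨huv, nI.1 (Finset.mem_insert_self _ _)⟩

end Reconfiguration

/-! ### The number of vertices of an irreducible degenerate graph -/

section Kernel

open Classical

variable {V : Type*} {G : SimpleGraph V}

/-- Removing a vertex of degree at most `d` lowers the degree sum by twice its degree: once for the
vertex itself and once for its neighbours. -/
theorem sum_degree_le {A : Finset V} {d : ℕ}
    (h : ∀ S ⊆ A, S.Nonempty → ∃ v ∈ S, (S.filter fun u => G.Adj u v).card ≤ d) :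
    ∑ v ∈ A, (A.filter fun u => G.Adj u v).card ≤ 2 * d * A.card := by
  induction hn : A.card generalizing A with
  | zero => simp [Finset.card_eq_zero.1 hn]
  | succ n ih =>
    obtain ⟨v, hv, hdeg⟩ := h A subset_rfl (Finset.card_pos.1 (by omega))
    obtain ⟨B, hvB, rfl⟩ : ∃ B, v ∉ B ∧ A = insert v B :=
      ⟨A.erase v, Finset.notMem_erase _ _, (Finset.insert_erase hv).symm⟩
    have hB : B.card = n := by rw [Finset.card_insert_of_notMem hvB] at hn; omega
    have ih := ih (A := B) (fun S hS => h S (hS.trans (Finset.subset_insert _ _))) hB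
    have key : ∀ w ∈ B, ((insert v B).filter fun u => G.Adj u w).card =
        (B.filter fun u => G.Adj u w).card + if G.Adj w v then 1 else 0 := by
      intro w hw
      rw [Finset.filter_insert, G.adj_comm v w]
      split_ifs
      · rw [Finset.card_insert_of_notMem (by simp [hvB])]
      · rfl
    rw [Finset.sum_insert hvB, Finset.sum_congr rfl key, Finset.sum_add_distrib,
      ← Finset.card_filter]
    rw [Finset.filter_insert, if_neg (G.loopless.irrefl v)] at hdeg ⊢
    linarith [Nat.mul_succ (2 * d) n]

/-- In a `d`-degenerate graph, many vertices have degree at most `2 * d`. -/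
theorem card_le_card_lowDegree {A : Finset V} {d : ℕ}
    (h : ∀ S ⊆ A, S.Nonempty → ∃ v ∈ S, (S.filter fun u => G.Adj u v).card ≤ d) :
    A.card ≤ (2 * d + 1) *
      (A.filter fun v => (A.filter fun u => G.Adj u v).card ≤ 2 * d).card := by
  have hsum := sum_degree_le h
  have hsplit := Finset.card_filter_add_card_filter_not (s := A)
    fun v => (A.filter fun u => G.Adj u v).card ≤ 2 * d
  have hhigh : (A.filter fun v => ¬ (A.filter fun u => G.Adj u v).card ≤ 2 * d).card *
      -- With `H` the high-degree and `L` the low-degree vertices, (2d+1)|H| ≤ 2d(|L|+|H|), hence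
      -- |H| ≤ 2d|L| and |A| ≤ (2d+1)|L|.
      (2 * d + 1) ≤ ∑ v ∈ A, (A.filter fun u => G.Adj u v).card := by
    rw [← smul_eq_mul]
    refine (Finset.card_nsmul_le_sum _ _ _ fun v hv => ?_).trans
      (Finset.sum_le_sum_of_subset (Finset.filter_subset _ _))
    have := (Finset.mem_filter.1 hv).2
    omega
  rw [← hsplit] at hsum ⊢
  nlinarith

/-- The bound on the number of vertices with a given number of common neighbours. -/
def commonNeighborBound (k D : ℕ) : ℕ → ℕ
  | 0 => 0
  | m + 1 => D + k * D * commonNeighborBound k D m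

/-- Choose one counted vertex `v`, with its set `P`. At most `D` vertices lie in N[v]. Each other
counted `w` has a closed neighbour `u` outside N[v] that is also a closed neighbour of a member of
`P`. There are at most `k * D` such `u`, and `w` is counted again for `insert u C`. The number `m`
is the remaining depth: once `C` has more than `D` elements, no closed neighbourhood of a vertex of
`L` contains it. -/
theorem card_commonNeighbors_le {A L F : Finset V} {k D : ℕ} (hLA : L ⊆ A)
    (hdeg : ∀ v ∈ L, (A.filter fun u => G.ClosedAdj u v).card ≤ D)
    (h : ∀ v ∈ L, v ∉ F → ∃ P ⊆ L, P.card ≤ k ∧ ∀ w ∈ L, ¬ G.ClosedAdj w v →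
      ∃ p ∈ P, ∃ u ∈ A, ¬ G.ClosedAdj u v ∧ G.ClosedAdj u w ∧ G.ClosedAdj u p)
    (m : ℕ) {C : Finset V} (hCA : C ⊆ A) (hC : D + 1 ≤ C.card + m) :
    (L.filter fun w => w ∉ F ∧ ∀ c ∈ C, G.ClosedAdj c w).card ≤ commonNeighborBound k D m := by
  induction m generalizing C with
  | zero =>
    rw [commonNeighborBound, Nat.le_zero, Finset.card_eq_zero, Finset.filter_eq_empty_iff]
    rintro v hv ⟨-, hvC⟩
    have : C.card ≤ (A.filter fun u => G.ClosedAdj u v).card :=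
      Finset.card_le_card fun c hc => Finset.mem_filter.2 ⟨hCA hc, hvC c hc⟩
    have := hdeg v hv
    omega
  | succ m ih =>
    obtain h0 | ⟨v, hv⟩ := (L.filter fun w => w ∉ F ∧ ∀ c ∈ C, G.ClosedAdj c w).eq_empty_or_nonempty
    · simp [h0]
    obtain ⟨hvL, hvF, hvC⟩ := Finset.mem_filter.1 hv
    obtain ⟨P, hPL, hPk, hP⟩ := h v hvL hvF
    let X : Finset V := P.biUnion fun p => A.filter fun u => ¬ G.ClosedAdj u v ∧ G.ClosedAdj u p
    have hX : X.card ≤ k * D := by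
      refine (Finset.card_biUnion_le_card_mul _ _ D fun p hp => ?_).trans (Nat.mul_le_mul_right D hPk)
      exact (Finset.card_le_card (Finset.monotone_filter_right _ fun u _ h => h.2)).trans
        (hdeg p (hPL hp))
    have hsub : (L.filter fun w => w ∉ F ∧ ∀ c ∈ C, G.ClosedAdj c w) ⊆
        (A.filter fun u => G.ClosedAdj u v) ∪
        X.biUnion fun u => L.filter fun w => w ∉ F ∧ ∀ c ∈ insert u C, G.ClosedAdj c w := by
      intro w hw
      obtain ⟨hwL, hwF, hwC⟩ := Finset.mem_filter.1 hw
      by_cases hwv : G.ClosedAdj w v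
      · exact Finset.mem_union_left _ (Finset.mem_filter.2 ⟨hLA hwL, hwv⟩)
      · obtain ⟨p, hp, u, hu, huv, huw, hup⟩ := hP w hwL hwv
        refine Finset.mem_union_right _ (Finset.mem_biUnion.2 ⟨u, ?_, ?_⟩)
        · exact Finset.mem_biUnion.2 ⟨p, hp, Finset.mem_filter.2 ⟨hu, huv, hup⟩⟩
        · refine Finset.mem_filter.2 ⟨hwL, hwF, fun c hc => ?_⟩
          obtain rfl | hc := Finset.mem_insert.1 hc
          · exact huw
          · exact hwC c hc
    refine (Finset.card_le_card hsub).trans ((Finset.card_union_le _ _).trans ?_)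
    refine add_le_add (hdeg v hvL) ((Finset.card_biUnion_le_card_mul _ _ _ fun u hu => ?_).trans
      (Nat.mul_le_mul_right (commonNeighborBound k D m) hX))
    obtain ⟨p, -, hu⟩ := Finset.mem_biUnion.1 hu
    obtain ⟨huA, huv, -⟩ := Finset.mem_filter.1 hu
    refine ih (Finset.insert_subset huA hCA) ?_
    -- `C` lies in N[v] and `u` does not, so `C` really grows.
    rw [Finset.card_insert_of_notMem fun hc => huv (hvC u hc)]
    omega

/-- The bound on the number of vertices of an irreducible graph. -/
def kernelBound (k d : ℕ) : ℕ :=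
  -- Closed neighbourhoods of low-degree vertices have at most D = 2d+1 elements; the depth D+1 =
  -- 2d+2 belongs to the start with empty `C`; `2 * k` accounts for source and target.
  (2 * d + 1) * (commonNeighborBound k (2 * d + 1) (2 * d + 2) + 2 * k)

/-- The count of common neighbours with `C = ∅` bounds the low-degree vertices outside `F`, and
these together with `F` make up a fixed fraction of `A`. -/
theorem card_le_kernelBound {A F : Finset V} {k d : ℕ} (hF : F.card ≤ 2 * k)
    (hdeg : ∀ S ⊆ A, S.Nonempty → ∃ v ∈ S, (S.filter fun u => G.Adj u v).card ≤ d)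
    (h : ∀ v ∈ A, (A.filter fun u => G.Adj u v).card ≤ 2 * d → v ∉ F →
      ∃ P ⊆ A, (∀ p ∈ P, (A.filter fun u => G.Adj u p).card ≤ 2 * d) ∧ P.card ≤ k ∧
        ∀ w ∈ A, (A.filter fun u => G.Adj u w).card ≤ 2 * d → ¬ G.ClosedAdj w v →
        ∃ p ∈ P, ∃ u ∈ A, ¬ G.ClosedAdj u v ∧ G.ClosedAdj u w ∧ G.ClosedAdj u p) :
    A.card ≤ kernelBound k d := by
  refine (card_le_card_lowDegree hdeg).trans (Nat.mul_le_mul_left _ ?_)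
  set L := A.filter fun v => (A.filter fun u => G.Adj u v).card ≤ 2 * d with hL
  have hLdeg : ∀ v ∈ L, (A.filter fun u => G.ClosedAdj u v).card ≤ 2 * d + 1 := by
    intro v hv
    have : (A.filter fun u => G.ClosedAdj u v) ⊆ insert v (A.filter fun u => G.Adj u v) := by
      intro u hu
      obtain ⟨huA, rfl | huv⟩ := Finset.mem_filter.1 hu
      · simp
      · simp [huA, huv]
    refine (Finset.card_le_card this).trans ((Finset.card_insert_le _ _).trans ?_)
    exact Nat.succ_le_succ (Finset.mem_filter.1 hv).2
  have key := card_commonNeighbors_le (G := G) (F := F) (k := k) (Finset.filter_subset _ _) hLdeg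
    (fun v hv hvF => by
      obtain ⟨P, hPA, hP, hPk, hPw⟩ := h v (Finset.mem_filter.1 hv).1 (Finset.mem_filter.1 hv).2 hvF
      exact ⟨P, fun p hp => Finset.mem_filter.2 ⟨hPA hp, hP p hp⟩, hPk, fun w hw =>
        hPw w (Finset.mem_filter.1 hw).1 (Finset.mem_filter.1 hw).2⟩)
    (2 * d + 2) (Finset.empty_subset _) (by simp)
  have hsub : L ⊆ (L.filter fun w => w ∉ F ∧ ∀ c ∈ (∅ : Finset V), G.ClosedAdj c w) ∪ F := by
    intro w hw
    by_cases hwF : w ∈ F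
    · exact Finset.mem_union_right _ hwF
    · exact Finset.mem_union_left _ (Finset.mem_filter.2 ⟨hw, hwF, by simp⟩)
  exact (Finset.card_le_card hsub).trans ((Finset.card_union_le _ _).trans (add_le_add key hF))

end Kernel

end SimpleGraph

/-! ### Formulas as expressions -/

namespace SumExpr

/-- An expression holds if its value is nonzero. -/
def Holds (m : ℕ → ℕ) (e : SumExpr) (ρ : ℕ → ℕ) : Prop := e.eval m ρ ≠ 0

/-- Negation. -/
def neg (a : SumExpr) : SumExpr := .sub (.const 1) a

/-- Conjunction. -/
def conj (a b : SumExpr) : SumExpr := .ite a b (.const 0)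

/-- Disjunction. -/
def disj (a b : SumExpr) : SumExpr := .ite a (.const 1) b

/-- Equivalence. -/
def equiv (a b : SumExpr) : SumExpr := .ite a b b.neg

/-- The comparison `a < b`. -/
def lt (a b : SumExpr) : SumExpr := .sub b a

/-- The comparison `a ≤ b`. -/
def le (a b : SumExpr) : SumExpr := .sub (.add b (.const 1)) a

/-- The comparison `a = b`. -/
def eq (a b : SumExpr) : SumExpr := conj (le a b) (le b a)

/-- Universal quantification over the numbers below the value of variable `0`. -/
def all (x : ℕ) (a : SumExpr) : SumExpr := neg (.sum x (neg a))

/-- The number of values below the value of variable `0` with a given property. -/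
def count (x : ℕ) (a : SumExpr) : SumExpr := .sum x (.ite a (.const 1) (.const 0))

/-- The product of two expressions, the first of which is at most the value of variable `0`; both
may only use the variables below `29`. -/
def mul (a b : SumExpr) : SumExpr := .sum 29 (.ite (lt (.var 29) a) b (.const 0))

variable {m ρ : ℕ → ℕ} {a b c : SumExpr} {x : ℕ}

@[simp] theorem eval_const (i : ℕ) : (const i).eval m ρ = i := rfl

@[simp] theorem eval_var : (var x).eval m ρ = ρ x := rfl

@[simp] theorem eval_add : (add a b).eval m ρ = a.eval m ρ + b.eval m ρ := rfl

@[simp] theorem eval_sub : (sub a b).eval m ρ = a.eval m ρ - b.eval m ρ := rfl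

@[simp] theorem eval_load : (load a).eval m ρ = m (a.eval m ρ) := rfl

open Classical in
theorem eval_ite : (ite c a b).eval m ρ = if c.Holds m ρ then a.eval m ρ else b.eval m ρ := by
  simp only [Holds, eval]; congr

theorem eval_sum :
    (sum x a).eval m ρ = ∑ i ∈ Finset.range (ρ 0), a.eval m (Function.update ρ x i) := rfl

theorem holds_load : (load a).Holds m ρ ↔ m (a.eval m ρ) ≠ 0 := Iff.rfl

@[simp] theorem holds_neg : (neg a).Holds m ρ ↔ ¬ a.Holds m ρ := by
  simp only [Holds, neg, eval]; omega

@[simp] theorem holds_conj : (conj a b).Holds m ρ ↔ a.Holds m ρ ∧ b.Holds m ρ := by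
  simp only [Holds, conj, eval]; split_ifs <;> simp_all

@[simp] theorem holds_disj : (disj a b).Holds m ρ ↔ a.Holds m ρ ∨ b.Holds m ρ := by
  simp only [Holds, disj, eval]; split_ifs <;> simp_all

@[simp] theorem holds_equiv : (equiv a b).Holds m ρ ↔ (a.Holds m ρ ↔ b.Holds m ρ) := by
  simp only [Holds, equiv, neg, eval]; (split_ifs <;> simp_all); omega

@[simp] theorem holds_lt : (lt a b).Holds m ρ ↔ a.eval m ρ < b.eval m ρ := by
  simp only [Holds, lt, eval]; omega

@[simp] theorem holds_le : (le a b).Holds m ρ ↔ a.eval m ρ ≤ b.eval m ρ := by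
  simp only [Holds, le, eval]; omega

@[simp] theorem holds_eq : (eq a b).Holds m ρ ↔ a.eval m ρ = b.eval m ρ := by
  rw [eq, holds_conj, holds_le, holds_le, le_antisymm_iff]

@[simp] theorem holds_sum :
    (sum x a).Holds m ρ ↔ ∃ i < ρ 0, a.Holds m (Function.update ρ x i) := by
  simp [Holds, eval]

@[simp] theorem holds_all :
    (all x a).Holds m ρ ↔ ∀ i < ρ 0, a.Holds m (Function.update ρ x i) := by
  simp [all]

open Classical in
theorem eval_count : (count x a).eval m ρ =
    ((Finset.range (ρ 0)).filter fun i => a.Holds m (Function.update ρ x i)).card := by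
  simp [count, eval_sum, eval_ite]

theorem eval_mul (ha : a.WellFormed 29) (hb : b.WellFormed 29) (h : a.eval m ρ ≤ ρ 0) :
    (mul a b).eval m ρ = a.eval m ρ * b.eval m ρ := by
  have key : ∀ {e : SumExpr} (i : ℕ), e.WellFormed 29 →
      e.eval m (Function.update ρ 29 i) = e.eval m ρ := fun i he =>
    eval_congr he (by simp) fun j hj => by simp [Function.update, hj.ne]
  classical
  rw [mul, eval_sum]
  simp only [eval_ite, holds_lt, key _ ha, key _ hb, eval_var, Function.update_self, eval_const]
  rw [← Finset.sum_filter, Finset.sum_const, smul_eq_mul]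
  congr 1
  convert Finset.card_range (a.eval m ρ) using 2
  ext i
  simp only [Finset.mem_filter, Finset.mem_range]
  omega

end SumExpr

namespace LoopProgram

/-- The effect of a loop that computes the entries of an array one after the other. -/
theorem exec_loop_store {x : ℕ} {b e : SumExpr} {ρ m : ℕ → ℕ} {β : ℕ}
    (hb : ∀ m' i, b.eval m' (Function.update ρ x i) = β) :
    ∃ μ : ℕ → ℕ → ℕ, (loop x (store (.add b (.var x)) e)).exec ρ m = μ (ρ 0) ∧
      (∀ i a, (a < β ∨ β + i ≤ a) → μ i a = m a) ∧
      (∀ i ≤ ρ 0, ∀ a < β + i, μ i a = μ (ρ 0) a) ∧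
      ∀ i < ρ 0, μ (ρ 0) (β + i) = e.eval (μ i) (Function.update ρ x i) := by
  -- `μ j` is the memory before round `j`: entries below `j` are final and the others are still old.
  -- Thus a round may use the entries already computed.
  let μ : ℕ → ℕ → ℕ := fun j => Nat.rec m
    (fun i m' => (store (.add b (.var x)) e).exec (Function.update ρ x i) m') j
  have hμ : ∀ i, μ (i + 1) =
      Function.update (μ i) (β + i) (e.eval (μ i) (Function.update ρ x i)) := by
    intro i
    change Function.update _ _ _ = _
    simp only [SumExpr.eval_add, hb, SumExpr.eval_var, Function.update_self]
    rfl
  have hstable : ∀ j i, i ≤ j → ∀ a < β + i, μ i a = μ j a := by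
    intro j
    induction j with
    | zero => intro i hi a _; obtain rfl : i = 0 := by omega
              rfl
    | succ j ih =>
      intro i hi a ha
      obtain rfl | hi' : i = j + 1 ∨ i ≤ j := by omega
      · rfl
      · rw [ih i hi' a ha, hμ, Function.update_of_ne (by omega)]
  refine ⟨μ, rfl, ?_, hstable (ρ 0), ?_⟩
  · intro i
    induction i with
    | zero => exact fun _ _ => rfl
    | succ i ih =>
      intro a ha
      rw [hμ, Function.update_of_ne (by omega), ih a (by omega)]
  · intro i hi
    rw [← hstable (ρ 0) (i + 1) hi (β + i) (by omega), hμ, Function.update_self]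

/-- Induction over the rounds of a loop. -/
theorem exec_loop_induction {x : ℕ} {P : LoopProgram} {ρ m : ℕ → ℕ} {Inv : ℕ → (ℕ → ℕ) → Prop}
    (h0 : Inv 0 m)
    (hstep : ∀ i < ρ 0, ∀ m', Inv i m' → Inv (i + 1) (P.exec (Function.update ρ x i) m')) :
    Inv (ρ 0) ((loop x P).exec ρ m) := by
  suffices H : ∀ j ≤ ρ 0, Inv j (Nat.rec m (fun i m' => P.exec (Function.update ρ x i) m') j) from
    H _ le_rfl
  intro j
  induction j with
  | zero => exact fun _ => h0
  | succ j ih => exact fun hj => hstep j (by omega) _ (ih (by omega))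

end LoopProgram

/-! ### Access to the input -/

namespace DegenerateISR

open SumExpr

/-- The memory starts with the encoding of an instance. -/
structure IsInput (m : ℕ → ℕ) (n k d : ℕ) (G : SimpleGraph ℕ) (S T : Finset ℕ) : Prop where
  n_eq : m 0 = n
  k_eq : m 1 = k
  d_eq : m 2 = d
  source_iff : ∀ v < n, m (3 + v) ≠ 0 ↔ v ∈ S
  target_iff : ∀ v < n, m (3 + n + v) ≠ 0 ↔ v ∈ T
  adj_iff : ∀ u < n, ∀ v < n, m (3 + n + n + (u * n + v)) ≠ 0 ↔ G.Adj u v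

/-- The length of the input. -/
def inputLength (n : ℕ) : ℕ := 3 + n + n + n * n

theorem IsInput.congr {m m' : ℕ → ℕ} {n k d : ℕ} {G : SimpleGraph ℕ} {S T : Finset ℕ}
    (h : IsInput m n k d G S T) (hm : ∀ a < inputLength n, m' a = m a) :
    IsInput m' n k d G S T := by
  unfold inputLength at hm
  refine ⟨?_, ?_, ?_, fun v hv => ?_, fun v hv => ?_, fun u hu v hv => ?_⟩
  · rw [hm _ (by omega), h.n_eq]
  · rw [hm _ (by omega), h.k_eq]
  · rw [hm _ (by omega), h.d_eq]
  · rw [hm _ (by omega), h.source_iff v hv]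
  · rw [hm _ (by omega), h.target_iff v hv]
  · rw [hm _ (by nlinarith), h.adj_iff u hu v hv]

/-- The values of the variables `0, …, 4`: a bound for the loops, the numbers `n`, `k` and `d` of the
instance, and the length of the input. -/
structure IsEnv (ρ : ℕ → ℕ) (B n k d : ℕ) : Prop where
  bound : ρ 0 = B
  n_eq : ρ 1 = n
  k_eq : ρ 2 = k
  d_eq : ρ 3 = d
  length_eq : ρ 4 = inputLength n

theorem IsEnv.update {ρ : ℕ → ℕ} {B n k d x i : ℕ} (h : IsEnv ρ B n k d) (hx : 5 ≤ x) :
    IsEnv (Function.update ρ x i) B n k d := by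
  constructor <;> rw [Function.update_of_ne (by omega)]
  exacts [h.bound, h.n_eq, h.k_eq, h.d_eq, h.length_eq]

/-- `v` is in the source. -/
def sourceExpr (v : ℕ) : SumExpr := .load (.add (.const 3) (.var v))

/-- `v` is in the target. -/
def targetExpr (v : ℕ) : SumExpr := .load (.add (.add (.const 3) (.var 1)) (.var v))

/-- `u` and `v` are adjacent. -/
def adjExpr (u v : ℕ) : SumExpr :=
  .load (.add (.add (.add (.const 3) (.var 1)) (.var 1)) (.add (mul (.var u) (.var 1)) (.var v)))

/-- `u` is in the closed neighbourhood of `v`. -/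
def closedAdjExpr (u v : ℕ) : SumExpr := disj (eq (.var u) (.var v)) (adjExpr u v)

/-- The entry of the first array in the working memory at `v`. -/
def aliveExpr (v : ℕ) : SumExpr := .load (.add (.var 4) (.var v))

/-- The entry of the second array in the working memory at `v`. -/
def packExpr (v : ℕ) : SumExpr := .load (.add (.add (.var 4) (.var 1)) (.var v))

/-- The entry of the third array in the working memory at `v`. -/
def weightExpr (v : ℕ) : SumExpr := .load (.add (.add (.add (.var 4) (.var 1)) (.var 1)) (.var v))

/-- The entry of the fourth array in the working memory at `v`. -/
def markExpr (c : ℕ) : SumExpr :=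
  .load (.add (.add (.add (.add (.var 4) (.var 1)) (.var 1)) (.var 1)) (.var c))

section

variable {m ρ : ℕ → ℕ} {B n k d : ℕ} {G : SimpleGraph ℕ} {S T : Finset ℕ} {u v : ℕ}

theorem holds_sourceExpr (hm : IsInput m n k d G S T) (hv : ρ v < n) :
    (sourceExpr v).Holds m ρ ↔ ρ v ∈ S := by
  rw [sourceExpr, holds_load, ← hm.source_iff _ hv]; rfl

theorem holds_targetExpr (hm : IsInput m n k d G S T) (hρ : IsEnv ρ B n k d) (hv : ρ v < n) :
    (targetExpr v).Holds m ρ ↔ ρ v ∈ T := by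
  rw [targetExpr, holds_load, ← hm.target_iff _ hv, ← hρ.n_eq]; rfl

/-- The machine has no multiplication, so the row offset is a sum over the loop range. This requires
`ρ u ≤ B`, and `u < 29` so that the summation variable captures nothing. -/
theorem holds_adjExpr (hm : IsInput m n k d G S T) (hρ : IsEnv ρ B n k d) (hB : n ≤ B)
    (hu : ρ u < n) (hv : ρ v < n) (hu' : u < 29) :
    (adjExpr u v).Holds m ρ ↔ G.Adj (ρ u) (ρ v) := by
  rw [adjExpr, holds_load, ← hm.adj_iff _ hu _ hv, ← hρ.n_eq]
  simp only [eval_add, eval_const, eval_var]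
  rw [eval_mul (by exact hu') (by decide), eval_var, eval_var]
  rw [eval_var, hρ.bound]; omega

theorem holds_closedAdjExpr (hm : IsInput m n k d G S T) (hρ : IsEnv ρ B n k d) (hB : n ≤ B)
    (hu : ρ u < n) (hv : ρ v < n) (hu' : u < 29) :
    (closedAdjExpr u v).Holds m ρ ↔ G.ClosedAdj (ρ u) (ρ v) := by
  rw [closedAdjExpr, holds_disj, holds_adjExpr hm hρ hB hu hv hu']
  simp [SimpleGraph.ClosedAdj]

theorem holds_aliveExpr (hρ : IsEnv ρ B n k d) :
    (aliveExpr v).Holds m ρ ↔ m (inputLength n + ρ v) ≠ 0 := by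
  rw [aliveExpr, holds_load, ← hρ.length_eq]; rfl

theorem holds_packExpr (hρ : IsEnv ρ B n k d) :
    (packExpr v).Holds m ρ ↔ m (inputLength n + n + ρ v) ≠ 0 := by
  rw [packExpr, holds_load, ← hρ.length_eq, ← hρ.n_eq]; rfl

theorem eval_weightExpr (hρ : IsEnv ρ B n k d) :
    (weightExpr v).eval m ρ = m (inputLength n + n + n + ρ v) := by
  rw [weightExpr, eval_load, ← hρ.length_eq, ← hρ.n_eq]; rfl

theorem holds_markExpr (hρ : IsEnv ρ B n k d) :
    (markExpr v).Holds m ρ ↔ m (inputLength n + n + n + n + ρ v) ≠ 0 := by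
  rw [markExpr, holds_load, ← hρ.length_eq, ← hρ.n_eq]; rfl

end

/-- The set of vertices recorded in the first array. -/
def aliveSet (m : ℕ → ℕ) (n : ℕ) : Finset ℕ :=
  (Finset.range n).filter fun v => m (inputLength n + v) ≠ 0

theorem mem_aliveSet {m : ℕ → ℕ} {n v : ℕ} :
    v ∈ aliveSet m n ↔ v < n ∧ m (inputLength n + v) ≠ 0 := by
  simp [aliveSet]

theorem lt_of_mem_aliveSet {m : ℕ → ℕ} {n v : ℕ} (h : v ∈ aliveSet m n) : v < n :=
  (mem_aliveSet.1 h).1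

end DegenerateISR

/-! ### The reduction to a kernel -/

namespace DegenerateISR

open SumExpr Classical

/-- `v` has degree at most `2 * d` in the graph on `A`. -/
def LowDegree (G : SimpleGraph ℕ) (A : Finset ℕ) (d v : ℕ) : Prop :=
  (A.filter fun u => G.Adj u v).card ≤ 2 * d

/-- Outside the closed neighbourhood of `v`, the closed neighbourhoods of `w` and `p` meet. -/
def Conflict (G : SimpleGraph ℕ) (A : Finset ℕ) (v w p : ℕ) : Prop :=
  ∃ u ∈ A, ¬ G.ClosedAdj u v ∧ G.ClosedAdj u w ∧ G.ClosedAdj u p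

/-- The expression for `LowDegree`. -/
def lowDegreeExpr (v : ℕ) : SumExpr :=
  le (count 20 (conj (aliveExpr 20) (adjExpr 20 v))) (.add (.var 3) (.var 3))

/-- The expression for `Conflict`. -/
def conflictExpr (v w p : ℕ) : SumExpr :=
  .sum 14 (conj (aliveExpr 14) (conj (neg (closedAdjExpr 14 v))
    (conj (closedAdjExpr 14 w) (closedAdjExpr 14 p))))

section

variable {m ρ : ℕ → ℕ} {n k d : ℕ} {G : SimpleGraph ℕ} {S T : Finset ℕ} {v w p : ℕ}

/-- During the reduction the loop bound is `n`, so loops run exactly over the vertices. Conditions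
such as `v ≠ 20` exclude capture by bound variables. -/
theorem holds_lowDegreeExpr (hm : IsInput m n k d G S T) (hρ : IsEnv ρ n n k d) (hv : ρ v < n)
    (hv' : v ≠ 20) : (lowDegreeExpr v).Holds m ρ ↔ LowDegree G (aliveSet m n) d (ρ v) := by
  rw [lowDegreeExpr, holds_le, eval_count, LowDegree, hρ.bound]
  have : ((Finset.range n).filter fun i =>
      (conj (aliveExpr 20) (adjExpr 20 v)).Holds m (Function.update ρ 20 i)) =
      (aliveSet m n).filter fun u => G.Adj u (ρ v) := by
    ext i
    simp only [Finset.mem_filter, Finset.mem_range, mem_aliveSet, and_assoc]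
    refine and_congr_right fun hi => ?_
    have hρ' := hρ.update (x := 20) (i := i) (by simp)
    rw [holds_conj, holds_aliveExpr hρ', holds_adjExpr hm hρ' le_rfl (by simpa)
      (by simpa [Function.update_of_ne hv']) (by simp)]
    simp [Function.update_of_ne hv']
  rw [this, eval_add, eval_var, hρ.d_eq, two_mul]

theorem holds_conflictExpr (hm : IsInput m n k d G S T) (hρ : IsEnv ρ n n k d) (hv : ρ v < n)
    (hw : ρ w < n) (hp : ρ p < n) (hv' : v ≠ 14) (hw' : w ≠ 14) (hp' : p ≠ 14) :
    (conflictExpr v w p).Holds m ρ ↔ Conflict G (aliveSet m n) (ρ v) (ρ w) (ρ p) := by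
  rw [conflictExpr, holds_sum, hρ.bound, Conflict]
  refine exists_congr fun i => ?_
  rw [mem_aliveSet, and_assoc]
  refine and_congr_right fun hi => ?_
  have hρ' := hρ.update (x := 14) (i := i) (by simp)
  simp only [holds_conj, holds_neg]
  rw [holds_aliveExpr hρ', holds_closedAdjExpr hm hρ' le_rfl, holds_closedAdjExpr hm hρ' le_rfl,
    holds_closedAdjExpr hm hρ' le_rfl]
  all_goals simp [Function.update_of_ne, *]

end

/-- The greedy selection, in the second array, of vertices outside the closed neighbourhood of the
vertex in variable `11`. -/
def packProgram : LoopProgram :=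
  .loop 12 (.store (.add (.add (.var 4) (.var 1)) (.var 12))
    (conj (aliveExpr 12) (conj (lowDegreeExpr 12) (conj (neg (closedAdjExpr 12 11))
      -- Only smaller entries are consulted; the others may be left over from the test of a
      -- different vertex.
      (neg (.sum 13 (conj (lt (.var 13) (.var 12)) (conj (packExpr 13)
        (conflictExpr 11 12 13)))))))))

/-- The deletion of the vertex in variable `11`, if it is seen to be irrelevant. -/
def deleteProgram : LoopProgram :=
  .store (.add (.var 4) (.var 11))
    (.ite (conj (lowDegreeExpr 11) (conj (neg (sourceExpr 11)) (conj (neg (targetExpr 11))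
      (le (.var 2) (count 12 (packExpr 12)))))) (.const 0) (aliveExpr 11))

/-- The reduction to a kernel. -/
def kernelProgram : LoopProgram :=
  .seq (.loop 10 (.store (.add (.var 4) (.var 10)) (.const 1)))
    (.loop 10 (.loop 11 (.seq packProgram deleteProgram)))

/-! ### Correctness of the reduction -/

section

variable {m ρ : ℕ → ℕ} {n k d : ℕ} {G : SimpleGraph ℕ} {S T : Finset ℕ}

/-- The greedy choice is described as a recursion on the final memory, since the entries below `w`
no longer change when `w` is treated. -/
theorem packProgram_spec (hm : IsInput m n k d G S T) (hρ : IsEnv ρ n n k d) (hv : ρ 11 < n) :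
    (∀ a < inputLength n + n, packProgram.exec ρ m a = m a) ∧
      ∀ w < n, packProgram.exec ρ m (inputLength n + n + w) ≠ 0 ↔
        w ∈ aliveSet m n ∧ LowDegree G (aliveSet m n) d w ∧ ¬ G.ClosedAdj w (ρ 11) ∧
        ¬ ∃ p < w, packProgram.exec ρ m (inputLength n + n + p) ≠ 0 ∧
          Conflict G (aliveSet m n) (ρ 11) w p := by
  obtain ⟨μ, hμ, hout, hin, hval⟩ := LoopProgram.exec_loop_store (m := m) (ρ := ρ) (x := 12)
    (b := .add (.var 4) (.var 1)) (β := inputLength n + n)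
    (e := conj (aliveExpr 12) (conj (lowDegreeExpr 12) (conj (neg (closedAdjExpr 12 11))
      (neg (.sum 13 (conj (lt (.var 13) (.var 12)) (conj (packExpr 13)
        (conflictExpr 11 12 13))))))))
    (fun m' i => by simp [hρ.n_eq, hρ.length_eq])
  rw [packProgram, hμ]
  refine ⟨fun a ha => hout _ a (.inl ha), fun w hw => ?_⟩
  rw [hρ.bound] at hin hval ⊢
  rw [hval w hw]
  have hm' : IsInput (μ w) n k d G S T := hm.congr fun a ha => hout _ a (.inl (by omega))
  have hA : aliveSet (μ w) n = aliveSet m n := by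
    ext i
    rw [mem_aliveSet, mem_aliveSet]
    refine and_congr_right fun hi => ?_
    rw [hout _ _ (.inl (by omega))]
  have hρ' := hρ.update (x := 12) (i := w) (by simp)
  have hw' : Function.update ρ 12 w 12 = w := by simp
  have hv' : Function.update ρ 12 w 11 = ρ 11 := by simp
  change (Holds _ _ _) ↔ _
  simp only [holds_conj, holds_neg]
  rw [holds_aliveExpr hρ', holds_lowDegreeExpr hm' hρ' (by simpa) (by simp),
    holds_closedAdjExpr hm' hρ' le_rfl (by simpa) (by simpa) (by simp), hA, hw', hv',
    hout _ _ (.inl (by omega)), mem_aliveSet, holds_sum, hρ'.bound]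
  simp only [hw, true_and]
  refine and_congr_right fun _ => and_congr_right fun _ => and_congr_right fun _ => not_congr ?_
  have hρ'' := fun i => hρ'.update (x := 13) (i := i) (by simp)
  constructor
  · rintro ⟨p, hp, h⟩
    rw [holds_conj, holds_conj, holds_lt, holds_packExpr (hρ'' p), holds_conflictExpr hm' (hρ'' p)
      (by simpa) (by simpa) (by simpa) (by simp) (by simp) (by simp), hA] at h
    simp only [eval_var, Function.update_self, ne_eq, Nat.reduceEqDiff, not_false_eq_true,
      Function.update_of_ne] at h
    refine ⟨p, h.1, ?_, h.2.2⟩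
    rw [← hin w hw.le _ (by omega)]
    exact h.2.1
  · rintro ⟨p, hp, h, h'⟩
    refine ⟨p, hp.trans hw, ?_⟩
    have hpn := hp.trans hw
    rw [holds_conj, holds_conj, holds_lt, holds_packExpr (hρ'' p), holds_conflictExpr hm' (hρ'' p)
      (by simpa) (by simpa) (by simpa) (by simp) (by simp) (by simp), hA]
    simp only [eval_var, Function.update_self, ne_eq, Nat.reduceEqDiff, not_false_eq_true,
      Function.update_of_ne]
    refine ⟨hp, ?_, h'⟩
    rw [hin w hw.le _ (by omega)]
    exact h

/-- There are at most `k` vertices of low degree such that each vertex of low degree is in conflict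
with one of them, among the vertices outside the closed neighbourhood of `v`. -/
def HasSmallPacking (G : SimpleGraph ℕ) (A : Finset ℕ) (k d v : ℕ) : Prop :=
  ∃ P ⊆ A, (∀ p ∈ P, LowDegree G A d p) ∧ P.card ≤ k ∧
    ∀ w ∈ A, LowDegree G A d w → ¬ G.ClosedAdj w v → ∃ p ∈ P, Conflict G A v w p

/-- Of two chosen vertices in conflict the larger would have been rejected, so the greedy set
satisfies the disjointness in `ReconfigReach.erase`. If it is too small for a deletion, its
maximality gives `HasSmallPacking`. -/
theorem exec_pack_delete (hm : IsInput m n k d G S T) (hρ : IsEnv ρ n n k d) (hv : ρ 11 < n)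
    {m' : ℕ → ℕ} (hm' : m' = (LoopProgram.seq packProgram deleteProgram).exec ρ m) :
    IsInput m' n k d G S T ∧
    ((aliveSet m' n = aliveSet m n ∧ (ρ 11 ∈ aliveSet m n → LowDegree G (aliveSet m n) d (ρ 11) →
        ρ 11 ∉ S ∪ T → HasSmallPacking G (aliveSet m n) k d (ρ 11))) ∨
      (ρ 11 ∈ aliveSet m n ∧ ρ 11 ∉ S ∧ ρ 11 ∉ T ∧
        aliveSet m' n = (aliveSet m n).erase (ρ 11) ∧
        (G.ReconfigReach k (aliveSet m n) S T →
          G.ReconfigReach k ((aliveSet m n).erase (ρ 11)) S T))) := by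
  obtain ⟨hsame, hpack⟩ := packProgram_spec hm hρ hv
  set m₁ := packProgram.exec ρ m with hm₁
  set A := aliveSet m n with hA
  set v := ρ 11 with hv11
  have hm₁' : IsInput m₁ n k d G S T := hm.congr fun a ha => hsame a (by omega)
  have hA₁ : aliveSet m₁ n = A := by
    ext i
    rw [mem_aliveSet, hA, mem_aliveSet]
    refine and_congr_right fun hi => ?_
    rw [hsame _ (by omega)]
  let P := (Finset.range n).filter fun w => m₁ (inputLength n + n + w) ≠ 0
  have hPmem : ∀ w, w ∈ P ↔ w ∈ A ∧ LowDegree G A d w ∧ ¬ G.ClosedAdj w v ∧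
      ¬ ∃ p ∈ P, p < w ∧ Conflict G A v w p := by
    intro w
    by_cases hw : w < n
    · simp only [P, Finset.mem_filter, Finset.mem_range, hw, true_and]
      rw [hpack w hw]
      refine and_congr_right fun _ => and_congr_right fun _ => and_congr_right fun _ =>
        not_congr (exists_congr fun p => ?_)
      constructor
      · rintro ⟨h1, h2, h3⟩
        exact ⟨⟨h1.trans hw, h2⟩, h1, h3⟩
      · rintro ⟨⟨_, h2⟩, h1, h3⟩
        exact ⟨h1, h2, h3⟩
    · refine iff_of_false (fun h => hw ?_) (fun h => hw (lt_of_mem_aliveSet h.1))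
      exact Finset.mem_range.1 (Finset.mem_filter.1 h).1
  have hcond : (conj (lowDegreeExpr 11) (conj (neg (sourceExpr 11)) (conj (neg (targetExpr 11))
      (le (.var 2) (count 12 (packExpr 12)))))).Holds m₁ ρ ↔
      LowDegree G A d v ∧ v ∉ S ∧ v ∉ T ∧ k ≤ P.card := by
    simp only [holds_conj, holds_neg]
    rw [holds_lowDegreeExpr hm₁' hρ hv (by simp), holds_sourceExpr hm₁' hv,
      holds_targetExpr hm₁' hρ hv, holds_le, eval_count, eval_var, hρ.k_eq, hρ.bound, hA₁]
    have : ((Finset.range n).filter fun i =>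
        (packExpr 12).Holds m₁ (Function.update ρ 12 i)) = P := by
      refine Finset.filter_congr fun i _ => ?_
      rw [holds_packExpr (hρ.update (by simp))]
      simp
    rw [this]
  have hval : m' = Function.update m₁ (inputLength n + v)
      (if LowDegree G A d v ∧ v ∉ S ∧ v ∉ T ∧ k ≤ P.card then 0 else m₁ (inputLength n + v)) := by
    rw [hm', LoopProgram.exec, ← hm₁, deleteProgram, LoopProgram.exec, eval_add, eval_var,
      hρ.length_eq, eval_var, eval_ite]
    simp only [hcond, eval_const]
    rw [aliveExpr, eval_load, eval_add, eval_var, eval_var, hρ.length_eq]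
  have hin' : IsInput m' n k d G S T := hm₁'.congr fun a ha => by
    rw [hval, Function.update_of_ne (by omega)]
  refine ⟨hin', ?_⟩
  split_ifs at hval with h
  · have hA' : aliveSet m' n = A.erase v := by
      ext i
      rw [mem_aliveSet, Finset.mem_erase, ← hA₁, mem_aliveSet, hval]
      by_cases hi : i = v
      · simp [hi]
      · rw [Function.update_of_ne (by omega)]
        tauto
    by_cases hvA : v ∈ A
    · refine .inr ⟨hvA, h.2.1, h.2.2.1, hA', fun hST => ?_⟩
      refine hST.erase (P := P) (fun w hw => ((hPmem w).1 hw).1)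
        (fun w hw => ((hPmem w).1 hw).2.2.1) ?_ h.2.2.2 h.2.1 h.2.2.1
      intro w hw w' hw' u hu huv huw huw'
      by_contra hne
      obtain hlt | hlt := Nat.lt_or_gt_of_ne hne
      · exact ((hPmem w').1 hw').2.2.2 ⟨w, hw, hlt, u, hu, huv, huw', huw⟩
      · exact ((hPmem w).1 hw).2.2.2 ⟨w', hw', hlt, u, hu, huv, huw, huw'⟩
    -- A vertex deleted earlier may pass the test again, which changes nothing.
    · exact .inl ⟨by rw [hA', Finset.erase_eq_of_notMem hvA], fun h => absurd h hvA⟩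
  · rw [Function.update_eq_self] at hval
    refine .inl ⟨by rw [hval, hA₁], fun hvA hlow hvF => ?_⟩
    rw [Finset.mem_union, not_or] at hvF
    refine ⟨P, fun w hw => ((hPmem w).1 hw).1, fun w hw => ((hPmem w).1 hw).2.1, ?_, ?_⟩
    · by_contra hk
      exact h ⟨hlow, hvF.1, hvF.2, by omega⟩
    · intro w hw hwlow hwv
      by_cases hwP : w ∈ P
      -- A chosen vertex is in conflict with itself, witnessed by itself.
      · exact ⟨w, hwP, w, hw, hwv, .inl rfl, .inl rfl⟩
      · by_contra hcon
        refine hwP ((hPmem w).2 ⟨hw, hwlow, hwv, fun ⟨p, hp, _, hc⟩ => hcon ⟨p, hp, hc⟩⟩)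

/-- What is preserved by the reduction. -/
structure IsReduced (m : ℕ → ℕ) (n k d : ℕ) (G : SimpleGraph ℕ) (S T : Finset ℕ) : Prop where
  isInput : IsInput m n k d G S T
  source_subset : S ⊆ aliveSet m n
  target_subset : T ⊆ aliveSet m n
  -- The converse needs no record, since it is the monotonicity of reachability in the vertex set.
  reach : G.ReconfigReach k (Finset.range n) S T → G.ReconfigReach k (aliveSet m n) S T

/-- If a round deletes nothing, all vertices were tested against the same set, so the small packings
exist simultaneously and the kernel bound applies. -/
theorem exec_round (hm : IsReduced m n k d G S T) (hρ : IsEnv ρ n n k d)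
    (hdeg : ∀ S ⊆ Finset.range n, S.Nonempty →
      ∃ v ∈ S, (S.filter fun u => G.Adj u v).card ≤ d)
    (hS : S.card = k) (hT : T.card = k) {m' : ℕ → ℕ}
    (hm' : m' = (LoopProgram.loop 11 (.seq packProgram deleteProgram)).exec ρ m) :
    IsReduced m' n k d G S T ∧ aliveSet m' n ⊆ aliveSet m n ∧
      (aliveSet m' n = aliveSet m n → (aliveSet m n).card ≤ SimpleGraph.kernelBound k d) := by
  have key := LoopProgram.exec_loop_induction (x := 11) (ρ := ρ) (m := m)
    (P := .seq packProgram deleteProgram)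
    (Inv := fun i m' => IsReduced m' n k d G S T ∧ aliveSet m' n ⊆ aliveSet m n ∧
      (aliveSet m' n = aliveSet m n → ∀ v < i, v ∈ aliveSet m n →
        LowDegree G (aliveSet m n) d v → v ∉ S ∪ T → HasSmallPacking G (aliveSet m n) k d v))
    ⟨hm, subset_rfl, by simp⟩ ?_
  · rw [← hm', hρ.bound] at key
    refine ⟨key.1, key.2.1, fun h => ?_⟩
    have hsub : aliveSet m n ⊆ Finset.range n := Finset.filter_subset _ _
    refine SimpleGraph.card_le_kernelBound (F := S ∪ T)
      ((Finset.card_union_le _ _).trans (by omega)) (fun X hX => hdeg X (hX.trans hsub)) ?_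
    intro v hv hlow hvF
    exact key.2.2 h v (lt_of_mem_aliveSet hv) hv hlow hvF
  · intro i hi m₁ ⟨hm₁, hsub, hpack⟩
    rw [hρ.bound] at hi
    obtain ⟨hin, h | h⟩ := exec_pack_delete hm₁.isInput (hρ.update (x := 11) (i := i) (by simp))
      (by simpa) rfl
    · obtain ⟨hA, h⟩ := h
      refine ⟨⟨hin, hA ▸ hm₁.source_subset, hA ▸ hm₁.target_subset, hA ▸ hm₁.reach⟩, hA ▸ hsub, ?_⟩
      rw [hA]
      intro hAA v hv
      obtain rfl | hv : v = i ∨ v < i := by omega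
      · simpa [hAA] using h
      · exact hpack hAA v hv
    · rw [Function.update_self] at h
      obtain ⟨hi, hiS, hiT, hA, hreach⟩ := h
      refine ⟨⟨hin, ?_, ?_, ?_⟩, ?_, ?_⟩
      · rw [hA]
        exact fun x hx => Finset.mem_erase.2 ⟨fun e => hiS (e ▸ hx), hm₁.source_subset hx⟩
      · rw [hA]
        exact fun x hx => Finset.mem_erase.2 ⟨fun e => hiT (e ▸ hx), hm₁.target_subset hx⟩
      · rw [hA]
        exact fun h => hreach (hm₁.reach h)
      · rw [hA]
        exact (Finset.erase_subset _ _).trans hsub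
      -- A vertex deleted in this round never returns, so the two sets cannot be equal.
      · intro heq
        have := hsub hi
        rw [← heq, hA] at this
        simp at this

/-- Each of the `n` rounds either deletes a vertex or certifies the bound, which persists because
the set only shrinks. If all rounds delete, nothing is left. -/
theorem kernelProgram_spec (hm : IsInput m n k d G S T) (hρ : IsEnv ρ n n k d)
    (hdeg : ∀ S ⊆ Finset.range n, S.Nonempty →
      ∃ v ∈ S, (S.filter fun u => G.Adj u v).card ≤ d)
    (hSn : S ⊆ Finset.range n) (hTn : T ⊆ Finset.range n)
    (hS : S.card = k) (hT : T.card = k) :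
    IsReduced (kernelProgram.exec ρ m) n k d G S T ∧
      (aliveSet (kernelProgram.exec ρ m) n).card ≤ SimpleGraph.kernelBound k d := by
  obtain ⟨μ, hμ, hout, -, hval⟩ := LoopProgram.exec_loop_store (m := m) (ρ := ρ) (x := 10)
    (b := .var 4) (β := inputLength n) (e := .const 1) (fun m' i => by simp [hρ.length_eq])
  rw [kernelProgram, LoopProgram.exec, hμ]
  rw [hρ.bound] at hval ⊢
  set m₁ := μ n
  have hA : aliveSet m₁ n = Finset.range n := by
    ext v
    rw [mem_aliveSet, Finset.mem_range]
    refine and_iff_left_of_imp fun hv => ?_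
    rw [hval v hv]; simp
  have hm₁ : IsReduced m₁ n k d G S T :=
    ⟨hm.congr fun a ha => hout _ _ (.inl ha), hA ▸ hSn, hA ▸ hTn, by rw [hA]; exact id⟩
  have key := LoopProgram.exec_loop_induction (x := 10) (ρ := ρ) (m := m₁)
    (P := .loop 11 (.seq packProgram deleteProgram))
    (Inv := fun i m' => IsReduced m' n k d G S T ∧
      ((aliveSet m' n).card ≤ SimpleGraph.kernelBound k d ∨ (aliveSet m' n).card + i ≤ n))
    ⟨hm₁, .inr (by simp [hA])⟩ ?_
  · refine ⟨key.1, ?_⟩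
    rw [hρ.bound] at key
    obtain h | h := key.2
    · exact h
    · omega
  · intro i hi m₂ ⟨hm₂, hcard⟩
    obtain ⟨h1, h2, h3⟩ := exec_round hm₂ (hρ.update (x := 10) (i := i) (by simp)) hdeg hS hT rfl
    refine ⟨h1, ?_⟩
    obtain h | h := hcard
    · exact .inl ((Finset.card_le_card h2).trans h)
    · obtain heq | hlt := h2.eq_or_ssubset
      · exact .inl (heq ▸ h3 heq)
      · have := Finset.card_lt_card hlt
        exact .inr (by omega)

end

end DegenerateISR

/-! ### The search in the kernel -/

namespace DegenerateISR

open SumExpr Classical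

/-- The number of elements of `A` below `v`. -/
def rank (A : Finset ℕ) (v : ℕ) : ℕ := (A.filter (· < v)).card

/-- The subset of `A` with number `c`. -/
def decode (A : Finset ℕ) (c : ℕ) : Finset ℕ := A.filter fun v => c.testBit (rank A v)

theorem mem_decode {A : Finset ℕ} {c v : ℕ} : v ∈ decode A c ↔ v ∈ A ∧ c.testBit (rank A v) := by
  simp [decode]

theorem decode_subset (A : Finset ℕ) (c : ℕ) : decode A c ⊆ A := Finset.filter_subset _ _

theorem rank_lt_card {A : Finset ℕ} {v : ℕ} (hv : v ∈ A) : rank A v < A.card :=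
  Finset.card_lt_card <| Finset.filter_ssubset.2 ⟨v, hv, by simp⟩

theorem rank_lt_rank {A : Finset ℕ} {u v : ℕ} (hu : u ∈ A) (h : u < v) : rank A u < rank A v :=
  Finset.card_lt_card <| Finset.ssubset_iff_subset_ne.2
    ⟨Finset.monotone_filter_right _ fun _ _ hx => lt_trans hx h, fun he => by
      have : u ∈ A.filter (· < v) := Finset.mem_filter.2 ⟨hu, h⟩
      rw [← he] at this
      simp at this⟩

theorem rank_injOn (A : Finset ℕ) : Set.InjOn (rank A) A := by
  intro u hu v hv h
  obtain hlt | rfl | hlt := lt_trichotomy u v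
  · exact absurd h (rank_lt_rank hu hlt).ne
  · rfl
  · exact absurd h (rank_lt_rank hv hlt).ne'

/-- The ranks of the elements of `A` are distinct and below `A.card`, so they serve as bit
positions. -/
theorem exists_decode_eq {A I : Finset ℕ} (h : I ⊆ A) : ∃ c < 2 ^ A.card, decode A c = I := by
  refine ⟨Nat.ofBits fun i : Fin A.card => decide (∃ v ∈ I, rank A v = i), Nat.ofBits_lt_two_pow _, ?_⟩
  ext v
  rw [mem_decode]
  constructor
  · rintro ⟨hv, hbit⟩
    rw [Nat.testBit_ofBits_lt _ _ (rank_lt_card hv), decide_eq_true_iff] at hbit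
    obtain ⟨u, hu, huv⟩ := hbit
    exact rank_injOn A (h hu) hv huv ▸ hu
  · intro hv
    refine ⟨h hv, ?_⟩
    rw [Nat.testBit_ofBits_lt _ _ (rank_lt_card (h hv)), decide_eq_true_iff]
    exact ⟨v, hv, rfl⟩

/-- This is the geometric sum 1 + (1 + 2 + ... + 2^(r-1)) = 2^r, as the elements below `v` have
ranks 0, ..., r-1. It produces powers of two by additions alone. -/
theorem one_add_sum_two_pow_rank (A : Finset ℕ) (v : ℕ) :
    1 + ∑ u ∈ A.filter (· < v), 2 ^ rank A u = 2 ^ rank A v := by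
  induction v with
  | zero => simp [rank]
  | succ v ih =>
    have hsplit : A.filter (· < v + 1) = if v ∈ A then insert v (A.filter (· < v)) else
        A.filter (· < v) := by
      ext u
      split_ifs with hv <;> simp only [Finset.mem_insert, Finset.mem_filter, Nat.lt_succ_iff_lt_or_eq]
      · constructor
        · rintro ⟨hu, h | h⟩ <;> simp [*]
        · rintro (rfl | ⟨hu, h⟩) <;> simp [*]
      · refine and_congr_right fun hu => ⟨?_, .inl⟩
        rintro (h | rfl)
        · exact h
        · exact absurd hu hv
    rw [show rank A (v + 1) = (A.filter (· < v + 1)).card from rfl, hsplit]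
    split_ifs with hv
    · rw [Finset.sum_insert (by simp), Finset.card_insert_of_notMem (by simp), pow_succ]
      change _ = 2 ^ rank A v * 2
      omega
    · exact ih

theorem one_add_sum_two_pow_rank_eq_card (A : Finset ℕ) :
    1 + ∑ u ∈ A, 2 ^ rank A u = 2 ^ A.card := by
  have h : A.filter (· < A.sup id + 1) = A := Finset.filter_true_of_mem fun u hu =>
    Nat.lt_succ_of_le (Finset.le_sup (f := id) hu)
  have := one_add_sum_two_pow_rank A (A.sup id + 1)
  rw [rank, h] at this
  exact this

/-- Bit `r` is set when `c` lies in an interval [(2i+1)p, (2i+2)p) with p = 2^r. The endpoints are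
written with the factor `i + 1`, which is at most `B`, so that `mul` can compute them. -/
theorem testBit_iff_exists {c r B : ℕ} (hc : c < B) :
    c.testBit r ↔ ∃ i < B, (i + 1) * (2 ^ r + 2 ^ r) - 2 ^ r ≤ c ∧
      c < (i + 1) * (2 ^ r + 2 ^ r) := by
  rw [Nat.testBit_eq_decide_div_mod_eq, decide_eq_true_iff]
  have hp : 0 < 2 ^ r := by positivity
  generalize 2 ^ r = p at hp
  constructor
  · intro h
    have h1 := Nat.div_add_mod c p
    have h2 := Nat.mod_lt c hp
    have h3 : c / p = 2 * (c / p / 2) + 1 := by omega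
    have h4 : c / p ≤ c := Nat.div_le_self _ _
    refine ⟨c / p / 2, by omega, ?_, ?_⟩
    · rw [h3] at h1
      generalize c / p / 2 = i at *
      have : (i + 1) * (p + p) = p * (2 * i + 1) + p := by ring
      omega
    · rw [h3] at h1
      generalize c / p / 2 = i at *
      have : (i + 1) * (p + p) = p * (2 * i + 1) + p := by ring
      omega
  · rintro ⟨i, -, h1, h2⟩
    have h3 : (i + 1) * (p + p) = (2 * i + 1) * p + p := by ring
    have h4 : (i + 1) * (p + p) = (2 * i + 1 + 1) * p := by ring
    have : c / p = 2 * i + 1 := Nat.div_eq_of_lt_le (by omega) (by omega)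
    omega

/-! ### Programs for coding and search -/

/-- The computation of the powers of two that belong to the vertices of the kernel. -/
def weightProgram : LoopProgram :=
  .loop 10 (.store (.add (.add (.add (.var 4) (.var 1)) (.var 1)) (.var 10))
    (.add (.const 1) (.sum 11 (.ite (conj (lt (.var 11) (.var 10)) (aliveExpr 11))
      (weightExpr 11) (.const 0)))))

/-- The number of vertices plus the number of subsets of the kernel. -/
def boundExpr : SumExpr :=
  .add (.var 1) (.add (.const 1) (.sum 11 (.ite (aliveExpr 11) (weightExpr 11) (.const 0))))

/-- The bit of the number in `c` at the position of the vertex `v`. -/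
def bitExpr (c v : ℕ) : SumExpr :=
  .sum 20 (conj
    (le (.sub (mul (.add (.var 20) (.const 1)) (.add (weightExpr v) (weightExpr v))) (weightExpr v))
      (.var c))
    (lt (.var c) (mul (.add (.var 20) (.const 1)) (.add (weightExpr v) (weightExpr v)))))

/-- The vertex `v` is in the set with number `c`. -/
def memExpr (c v : ℕ) : SumExpr :=
  -- In the search, loops run beyond `n`, so vertices have to be told from other numbers.
  conj (lt (.var v) (.var 1)) (conj (aliveExpr v) (bitExpr c v))

/-- The set with number `c` is a node of the reconfiguration graph. -/
def nodeExpr (c : ℕ) : SumExpr :=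
  conj (.all 11 (.all 12 (neg (conj (memExpr c 11) (conj (memExpr c 12) (adjExpr 11 12))))))
    (disj (eq (count 11 (memExpr c 11)) (.var 2))
      (eq (.add (count 11 (memExpr c 11)) (.const 1)) (.var 2)))

/-- The sets with numbers `c` and `c'` differ by one vertex. -/
def stepExpr (c c' : ℕ) : SumExpr :=
  eq (count 11 (neg (equiv (memExpr c 11) (memExpr c' 11)))) (.const 1)

/-- The set with number `c` consists of the vertices with the property `e` of the variable `11`. -/
def isSetExpr (c : ℕ) (e : SumExpr) : SumExpr :=
  .all 11 (disj (neg (lt (.var 11) (.var 1))) (equiv (memExpr c 11) e))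

/-- One round of the search. -/
def searchRound : LoopProgram :=
  .loop 10 (.store (.add (.add (.add (.add (.var 4) (.var 1)) (.var 1)) (.var 1)) (.var 10))
    (disj (markExpr 10) (conj (nodeExpr 10) (.sum 15 (conj (markExpr 15) (stepExpr 10 15))))))

/-- The search for the sets that can be reached from the source. -/
def searchProgram : LoopProgram :=
  .seq (.loop 10 (.store (.add (.add (.add (.add (.var 4) (.var 1)) (.var 1)) (.var 1)) (.var 10))
    (isSetExpr 10 (sourceExpr 11)))) (.loop 9 searchRound)

/-- The target has been reached. -/
def answerExpr : SumExpr := .sum 10 (conj (markExpr 10) (isSetExpr 10 (targetExpr 11)))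

/-- The memory holds the input, a set `A` of vertices and the powers of two that belong to them. -/
structure IsCoded (m : ℕ → ℕ) (n k d : ℕ) (G : SimpleGraph ℕ) (S T A : Finset ℕ) : Prop where
  isInput : IsInput m n k d G S T
  aliveSet_eq : aliveSet m n = A
  weight_eq : ∀ v < n, m (inputLength n + n + n + v) = 2 ^ rank A v

/-! ### Correctness of the search -/

section

variable {m m' ρ : ℕ → ℕ} {B n k d : ℕ} {G : SimpleGraph ℕ} {S T A : Finset ℕ} {c c' v : ℕ}

theorem aliveSet_congr (h : ∀ a < inputLength n + n, m' a = m a) : aliveSet m' n = aliveSet m n := by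
  ext v
  rw [mem_aliveSet, mem_aliveSet]
  refine and_congr_right fun hv => ?_
  rw [h _ (by omega)]

theorem IsCoded.congr (hm : IsCoded m n k d G S T A)
    (h : ∀ a < inputLength n + n + n + n, m' a = m a) : IsCoded m' n k d G S T A := by
  refine ⟨hm.isInput.congr fun a ha => h a (by omega), ?_, fun v hv => ?_⟩
  · rw [aliveSet_congr fun a ha => h a (by omega), hm.aliveSet_eq]
  · rw [h _ (by omega), hm.weight_eq v hv]

theorem IsCoded.mem_iff (hm : IsCoded m n k d G S T A) :
    v ∈ A ↔ v < n ∧ m (inputLength n + v) ≠ 0 := by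
  rw [← hm.aliveSet_eq, mem_aliveSet]

/-- Each weight is one plus the sum of the weights of the smaller alive vertices, which are already
final; so strong induction applies, with `one_add_sum_two_pow_rank`. -/
theorem weightProgram_spec (hm : IsInput m n k d G S T) (hρ : IsEnv ρ n n k d) :
    IsCoded (weightProgram.exec ρ m) n k d G S T (aliveSet m n) := by
  obtain ⟨μ, hμ, hout, hin, hval⟩ := LoopProgram.exec_loop_store (m := m) (ρ := ρ) (x := 10)
    (b := .add (.add (.var 4) (.var 1)) (.var 1)) (β := inputLength n + n + n)
    (e := .add (.const 1) (.sum 11 (.ite (conj (lt (.var 11) (.var 10)) (aliveExpr 11))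
      (weightExpr 11) (.const 0))))
    (fun m' i => by simp [hρ.n_eq, hρ.length_eq])
  rw [weightProgram, hμ]
  rw [hρ.bound] at hin hval ⊢
  refine ⟨hm.congr fun a ha => hout _ a (.inl (by omega)),
    aliveSet_congr fun a ha => hout _ a (.inl (by omega)), fun v hv => ?_⟩
  induction v using Nat.strong_induction_on with
  | _ v ih =>
    rw [hval v hv, ← one_add_sum_two_pow_rank, eval_add, eval_const, eval_sum,
      Function.update_of_ne (by simp), hρ.bound]
    congr 1
    have hρ' := fun i => (hρ.update (x := 10) (i := v) (by simp)).update (x := 11) (i := i) (by simp)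
    simp only [eval_ite, holds_conj, holds_aliveExpr (hρ' _), eval_weightExpr (hρ' _), holds_lt,
      eval_var, Function.update_self, eval_const]
    rw [← Finset.sum_filter]
    refine Finset.sum_congr ?_ fun u hu => ?_
    · ext u
      rw [Finset.mem_filter, Finset.mem_filter, Finset.mem_range, mem_aliveSet]
      by_cases hu : u < n
      · rw [hout v _ (.inl (by omega))]
        tauto
      · tauto
    · obtain ⟨hu, huv⟩ := Finset.mem_filter.1 hu
      rw [hin v hv.le _ (by omega)]
      exact ih u huv (lt_of_mem_aliveSet hu)

/-- This becomes the new loop bound: large enough for both vertices and codes. -/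
theorem eval_boundExpr (hm : IsCoded m n k d G S T A) (hρ : IsEnv ρ n n k d) :
    boundExpr.eval m ρ = n + 2 ^ A.card := by
  rw [boundExpr, ← one_add_sum_two_pow_rank_eq_card, eval_add, eval_add, eval_const, eval_sum,
    eval_var, hρ.n_eq, hρ.bound]
  have hρ' := fun i => hρ.update (x := 11) (i := i) (by simp)
  simp only [eval_ite, holds_aliveExpr (hρ' _), eval_weightExpr (hρ' _), Function.update_self,
    eval_const]
  rw [← Finset.sum_filter]
  congr 2
  refine Finset.sum_congr hm.aliveSet_eq fun u hu => hm.weight_eq u ?_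
  exact (hm.mem_iff.1 hu).1

theorem holds_bitExpr (hm : IsCoded m n k d G S T A) (hρ : IsEnv ρ B n k d) (hc : ρ c < B)
    (hv : ρ v < n) (hc' : c ≠ 20) (hv' : v < 20) :
    (bitExpr c v).Holds m ρ ↔ (ρ c).testBit (rank A (ρ v)) := by
  rw [bitExpr, holds_sum, testBit_iff_exists hc, hρ.bound]
  refine exists_congr fun i => and_congr_right fun hi => ?_
  have hρ' := hρ.update (x := 20) (i := i) (by simp)
  have hw : (weightExpr v).eval m (Function.update ρ 20 i) = 2 ^ rank A (ρ v) := by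
    rw [eval_weightExpr hρ', Function.update_of_ne hv'.ne, hm.weight_eq _ hv]
  have hwf : (weightExpr v).WellFormed 29 :=
    ⟨⟨⟨by decide, by decide⟩, by decide⟩, show v < 29 by omega⟩
  have hmul : (mul (.add (.var 20) (.const 1)) (.add (weightExpr v) (weightExpr v))).eval m
      (Function.update ρ 20 i) = (i + 1) * (2 ^ rank A (ρ v) + 2 ^ rank A (ρ v)) := by
    rw [eval_mul (a := .add (.var 20) (.const 1)) (b := .add (weightExpr v) (weightExpr v))
      (by decide) ⟨hwf, hwf⟩]
    · simp [hw]
    · rw [hρ'.bound]; simpa using hi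
  rw [holds_conj, holds_le, holds_lt, eval_sub, hmul, hw, eval_var, Function.update_of_ne hc']

theorem holds_memExpr (hm : IsCoded m n k d G S T A) (hρ : IsEnv ρ B n k d) (hc : ρ c < B)
    (hc' : c ≠ 20) (hv' : v < 20) :
    (memExpr c v).Holds m ρ ↔ ρ v ∈ decode A (ρ c) := by
  rw [memExpr, holds_conj, holds_conj, holds_lt, eval_var, eval_var, hρ.n_eq, mem_decode,
    hm.mem_iff, and_assoc]
  refine and_congr_right fun hv => ?_
  rw [holds_aliveExpr hρ, holds_bitExpr hm hρ hc hv hc' hv']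

theorem filter_range_eq {I : Finset ℕ} (hI : I ⊆ Finset.range B) :
    (Finset.range B).filter (· ∈ I) = I := by
  rw [Finset.filter_mem_eq_inter, Finset.inter_eq_right.2 hI]

theorem IsCoded.decode_subset (hm : IsCoded m n k d G S T A) : decode A c ⊆ Finset.range n :=
  fun _ hv => Finset.mem_range.2 (hm.mem_iff.1 (DegenerateISR.decode_subset A c hv)).1

theorem eval_count_memExpr (hm : IsCoded m n k d G S T A) (hρ : IsEnv ρ B n k d) (hB : n ≤ B)
    (hc : ρ c < B) (hc' : c ≠ 20) (hc'' : c ≠ 11) :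
    (count 11 (memExpr c 11)).eval m ρ = (decode A (ρ c)).card := by
  rw [eval_count, hρ.bound]
  congr 1
  refine .trans ?_ (filter_range_eq (hm.decode_subset.trans (Finset.range_subset_range.2 hB)))
  refine Finset.filter_congr fun i _ => ?_
  rw [holds_memExpr hm (hρ.update (by simp)) (by simpa [Function.update_of_ne hc'']) hc' (by simp),
    Function.update_self, Function.update_of_ne hc'']

theorem holds_nodeExpr (hm : IsCoded m n k d G S T A) (hρ : IsEnv ρ B n k d) (hB : n ≤ B)
    (hc : ρ c < B) (hc' : c ≠ 20) (hc₁ : c ≠ 11) (hc₂ : c ≠ 12) :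
    (nodeExpr c).Holds m ρ ↔ G.IsReconfigNode k A (decode A (ρ c)) := by
  have hsub := hm.decode_subset (c := ρ c)
  rw [nodeExpr, holds_conj, holds_disj, holds_eq, holds_eq, eval_add,
    eval_count_memExpr hm hρ hB hc hc' hc₁, eval_var, eval_const, hρ.k_eq,
    SimpleGraph.IsReconfigNode, and_iff_right (DegenerateISR.decode_subset A _)]
  refine and_congr_left fun _ => ?_
  rw [holds_all, hρ.bound]
  have key : ∀ u w, (neg (conj (memExpr c 11) (conj (memExpr c 12) (adjExpr 11 12)))).Holds m
      (Function.update (Function.update ρ 11 u) 12 w) ↔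
      (u ∈ decode A (ρ c) → w ∈ decode A (ρ c) → ¬ G.Adj u w) := by
    intro u w
    have hρ' := (hρ.update (x := 11) (i := u) (by simp)).update (x := 12) (i := w) (by simp)
    have hcc : Function.update (Function.update ρ 11 u) 12 w c = ρ c := by
      rw [Function.update_of_ne hc₂, Function.update_of_ne hc₁]
    rw [holds_neg, holds_conj, holds_conj, holds_memExpr hm hρ' (by rwa [hcc]) hc' (by simp),
      holds_memExpr hm hρ' (by rwa [hcc]) hc' (by simp), hcc]
    simp only [Function.update_self, ne_eq, Nat.reduceEqDiff, not_false_eq_true,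
      Function.update_of_ne, not_and]
    refine forall_congr' fun hu => forall_congr' fun hw => not_congr ?_
    have hu := Finset.mem_range.1 (hsub hu)
    have hw := Finset.mem_range.1 (hsub hw)
    rw [holds_adjExpr hm.isInput hρ' hB (by simpa) (by simpa) (by simp)]
    simp
  constructor
  · intro h u hu w hw _
    have hu' := Finset.mem_range.1 (hsub hu)
    have hw' := Finset.mem_range.1 (hsub hw)
    have := h u (by omega)
    rw [holds_all, Function.update_of_ne (by simp), hρ.bound] at this
    exact (key u w).1 (this w (by omega)) hu hw
  · intro h u _
    rw [holds_all]
    intro w _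
    exact (key u w).2 fun hu hw hadj => h hu hw hadj.ne hadj

theorem holds_stepExpr (hm : IsCoded m n k d G S T A) (hρ : IsEnv ρ B n k d) (hB : n ≤ B)
    (hc : ρ c < B) (hc' : ρ c' < B) (h₁ : c ≠ 20) (h₂ : c ≠ 11) (h₁' : c' ≠ 20) (h₂' : c' ≠ 11) :
    (stepExpr c c').Holds m ρ ↔ (symmDiff (decode A (ρ c)) (decode A (ρ c'))).card = 1 := by
  rw [stepExpr, holds_eq, eval_count, eval_const, hρ.bound]
  have : symmDiff (decode A (ρ c)) (decode A (ρ c')) ⊆ Finset.range B := by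
    refine Finset.Subset.trans ?_ (Finset.range_subset_range.2 hB)
    exact fun v hv => (Finset.mem_symmDiff.1 hv).elim (fun h => hm.decode_subset h.1)
      (fun h => hm.decode_subset h.1)
  rw [← filter_range_eq this]
  have : ((Finset.range B).filter fun i =>
      (neg (equiv (memExpr c 11) (memExpr c' 11))).Holds m (Function.update ρ 11 i)) =
      (Finset.range B).filter (· ∈ symmDiff (decode A (ρ c)) (decode A (ρ c'))) := by
    refine Finset.filter_congr fun i _ => ?_
    have hρ' := hρ.update (x := 11) (i := i) (by simp)
    rw [holds_neg, holds_equiv, holds_memExpr hm hρ' (by rwa [Function.update_of_ne h₂]) h₁ (by simp),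
      holds_memExpr hm hρ' (by rwa [Function.update_of_ne h₂']) h₁' (by simp),
      Function.update_self, Function.update_of_ne h₂, Function.update_of_ne h₂',
      Finset.mem_symmDiff]
    tauto
  rw [this]

theorem holds_isSetExpr (hm : IsCoded m n k d G S T A) (hρ : IsEnv ρ B n k d) (hB : n ≤ B)
    (hc : ρ c < B) (h₁ : c ≠ 20) (h₂ : c ≠ 11) {e : SumExpr} {I : Finset ℕ}
    (hI : I ⊆ Finset.range n)
    (he : ∀ v < n, e.Holds m (Function.update ρ 11 v) ↔ v ∈ I) :
    (isSetExpr c e).Holds m ρ ↔ decode A (ρ c) = I := by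
  rw [isSetExpr, holds_all, hρ.bound]
  have key : ∀ v, (disj (neg (lt (.var 11) (.var 1))) (equiv (memExpr c 11) e)).Holds m
      (Function.update ρ 11 v) ↔ (v < n → (v ∈ decode A (ρ c) ↔ v ∈ I)) := by
    intro v
    have hρ' := hρ.update (x := 11) (i := v) (by simp)
    rw [holds_disj, holds_neg, holds_lt, holds_equiv, eval_var, eval_var, hρ'.n_eq,
      Function.update_self, holds_memExpr hm hρ' (by rwa [Function.update_of_ne h₂]) h₁ (by simp),
      Function.update_self, Function.update_of_ne h₂, ← imp_iff_not_or]
    exact forall_congr' fun hv => by rw [he v hv]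
  simp only [key]
  constructor
  · intro h
    ext v
    by_cases hv : v < n
    · exact h v (hv.trans_le hB) hv
    · exact iff_of_false (fun h => hv (Finset.mem_range.1 (hm.decode_subset h)))
        (fun h => hv (Finset.mem_range.1 (hI h)))
  · rintro h v - -
    rw [h]

/-- The numbers that have been marked in the search. -/
def markSet (m : ℕ → ℕ) (B n : ℕ) : Finset ℕ :=
  (Finset.range B).filter fun c => m (inputLength n + n + n + n + c) ≠ 0

theorem mem_markSet : c ∈ markSet m B n ↔ c < B ∧ m (inputLength n + n + n + n + c) ≠ 0 := by
  simp [markSet]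

/-- Marks are updated in place, so code `c` sees the new marks of smaller codes and the old marks of
the others. -/
theorem searchRound_spec (hm : IsCoded m n k d G S T A) (hρ : IsEnv ρ B n k d) (hB : n ≤ B)
    (hm' : m' = searchRound.exec ρ m) :
    IsCoded m' n k d G S T A ∧ ∀ c, c ∈ markSet m' B n ↔ c ∈ markSet m B n ∨
      (c < B ∧ G.IsReconfigNode k A (decode A c) ∧
        ∃ c', (c' < c ∧ c' ∈ markSet m' B n ∨ c ≤ c' ∧ c' ∈ markSet m B n) ∧
          (symmDiff (decode A c) (decode A c')).card = 1) := by
  obtain ⟨μ, hμ, hout, hin, hval⟩ := LoopProgram.exec_loop_store (m := m) (ρ := ρ) (x := 10)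
    (b := .add (.add (.add (.var 4) (.var 1)) (.var 1)) (.var 1))
    (β := inputLength n + n + n + n)
    (e := disj (markExpr 10) (conj (nodeExpr 10) (.sum 15 (conj (markExpr 15) (stepExpr 10 15)))))
    (fun m' i => by simp [hρ.n_eq, hρ.length_eq])
  rw [searchRound, hμ] at hm'
  rw [hρ.bound] at hin hval hm'
  subst hm'
  refine ⟨hm.congr fun a ha => hout _ a (.inl ha), fun c => ?_⟩
  rw [mem_markSet, mem_markSet]
  by_cases hc : c < B
  swap
  · simp [hc]
  simp only [hc, true_and]
  rw [hval c hc]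
  have hρ' := hρ.update (x := 10) (i := c) (by simp)
  have hcoded : IsCoded (μ c) n k d G S T A := hm.congr fun a ha => hout _ a (.inl ha)
  change Holds _ _ _ ↔ _
  rw [holds_disj, holds_conj, holds_markExpr hρ', holds_nodeExpr hcoded hρ' hB (by simpa) (by simp)
    (by simp) (by simp), holds_sum, hρ'.bound, Function.update_self, hout c _ (.inr le_rfl)]
  refine or_congr_right (and_congr_right fun _ => exists_congr fun c' => ?_)
  have hρ'' := hρ'.update (x := 15) (i := c') (by simp)
  by_cases hcB : c' < B
  · rw [and_iff_right hcB, holds_conj, holds_markExpr hρ'', holds_stepExpr hcoded hρ'' hB (by simpa)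
      (by simpa) (by simp) (by simp) (by simp) (by simp), mem_markSet, mem_markSet]
    simp only [Function.update_self, ne_eq, Nat.reduceEqDiff, not_false_eq_true,
      Function.update_of_ne, hcB, true_and]
    refine and_congr_left fun _ => ?_
    obtain h | h := Nat.lt_or_ge c' c
    · rw [hin c hc.le _ (by omega)]
      simp [h, h.not_ge]
    · rw [hout c _ (.inr (by omega))]
      simp [h, h.not_gt]
  · simp [mem_markSet, hcB]

/-- A round that adds no mark shows that the marked sets are closed under steps; otherwise the
number of marks grows. After as many rounds as there are codes, the marks are closed or exhaust all
codes. Several codes may represent one set, so all codes of the source are marked initially. -/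
theorem searchProgram_spec (hm : IsCoded m n k d G S T A) (hρ : IsEnv ρ (n + 2 ^ A.card) n k d)
    (hS : G.IsReconfigNode k A S) (hm' : m' = searchProgram.exec ρ m) :
    IsCoded m' n k d G S T A ∧ ∀ c, c ∈ markSet m' (n + 2 ^ A.card) n ↔
      c < n + 2 ^ A.card ∧ G.ReconfigReach k A S (decode A c) := by
  set B := n + 2 ^ A.card with hBdef
  have hB : n ≤ B := Nat.le_add_right _ _
  have hSn : S ⊆ Finset.range n := fun v hv => Finset.mem_range.2 (hm.mem_iff.1 (hS.1 hv)).1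
  obtain ⟨μ, hμ, hout, hin, hval⟩ := LoopProgram.exec_loop_store (m := m) (ρ := ρ) (x := 10)
    (b := .add (.add (.add (.var 4) (.var 1)) (.var 1)) (.var 1))
    (β := inputLength n + n + n + n)
    (e := isSetExpr 10 (sourceExpr 11))
    (fun m' i => by simp [hρ.n_eq, hρ.length_eq])
  rw [searchProgram, LoopProgram.exec, hμ] at hm'
  rw [hρ.bound] at hval hm'
  have hm₁ : IsCoded (μ B) n k d G S T A := hm.congr fun a ha => hout _ a (.inl ha)
  have hmark : ∀ c, c ∈ markSet (μ B) B n ↔ c < B ∧ decode A c = S := by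
    intro c
    rw [mem_markSet]
    refine and_congr_right fun hc => ?_
    rw [hval c hc]
    have hcoded : IsCoded (μ c) n k d G S T A := hm.congr fun a ha => hout _ a (.inl ha)
    change Holds _ _ _ ↔ _
    rw [holds_isSetExpr hcoded (hρ.update (by simp)) hB (by simpa) (by simp) (by simp) hSn
      fun v hv => by
        rw [holds_sourceExpr hcoded.isInput (by simpa), Function.update_self],
      Function.update_self]
  have key := LoopProgram.exec_loop_induction (x := 9) (ρ := ρ) (m := μ B) (P := searchRound)
    (Inv := fun i m' => IsCoded m' n k d G S T A ∧
      (∀ c < B, decode A c = S → c ∈ markSet m' B n) ∧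
      (∀ c ∈ markSet m' B n, G.ReconfigReach k A S (decode A c)) ∧
      ((∀ c < B, G.ReconfigReach k A S (decode A c) → c ∈ markSet m' B n) ∨
        i ≤ (markSet m' B n).card))
    ⟨hm₁, fun c hc h => (hmark c).2 ⟨hc, h⟩,
      fun c hc => by rw [((hmark c).1 hc).2]; exact .refl, .inr (by simp)⟩ ?_
  · rw [← hm', hρ.bound] at key
    obtain ⟨h1, -, h2, h3⟩ := key
    refine ⟨h1, fun c => ⟨fun hc => ⟨(mem_markSet.1 hc).1, h2 c hc⟩, fun ⟨hc, hr⟩ => ?_⟩⟩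
    obtain h | h := h3
    · exact h c hc hr
    · have : markSet m' B n = Finset.range B :=
        Finset.eq_of_subset_of_card_le (Finset.filter_subset _ _) (by simpa using h)
      rw [this, Finset.mem_range]
      exact hc
  · intro i hi m₂ ⟨hm₂, hsrc, hsound, hcount⟩
    obtain ⟨hm₃, hiff⟩ := searchRound_spec hm₂ (hρ.update (x := 9) (i := i) (by simp)) hB rfl
    set m₃ := searchRound.exec (Function.update ρ 9 i) m₂
    have hsub : markSet m₂ B n ⊆ markSet m₃ B n := fun c hc => (hiff c).2 (.inl hc)
    have hnode : ∀ {I}, G.ReconfigReach k A S I → G.IsReconfigNode k A I := by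
      intro I hI
      obtain rfl | ⟨_, _, h⟩ := Relation.ReflTransGen.cases_tail hI
      · exact hS
      · exact h.2.1
    refine ⟨hm₃, fun c hc h => hsub (hsrc c hc h), ?_, ?_⟩
    -- Soundness needs strong induction over codes, as a mark may rest on one set earlier in the
    -- same round.
    · intro c
      induction c using Nat.strong_induction_on with
      | _ c ih =>
        intro hc
        obtain h | ⟨_, hn, c', h, hstep⟩ := (hiff c).1 hc
        · exact hsound c h
        · have hr : G.ReconfigReach k A S (decode A c') := by
            obtain ⟨h, h'⟩ | ⟨-, h⟩ := h
            · exact ih c' h h'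
            · exact hsound c' h
          exact hr.tail ⟨hnode hr, hn, by rw [symmDiff_comm]; exact hstep⟩
    · obtain h | h := hcount
      · exact .inl fun c hc hr => hsub (h c hc hr)
      obtain heq | hlt := hsub.eq_or_ssubset
      -- In a stationary round old and new marks agree, so induction along a path marks every code
      -- of each set on it.
      · refine .inl ?_
        suffices H : ∀ I, G.ReconfigReach k A S I → ∀ c < B, decode A c = I →
            c ∈ markSet m₃ B n from fun c hc hr => H _ hr c hc rfl
        intro I hI
        induction hI with
        | refl => exact fun c hc h => hsub (hsrc c hc h)
        | @tail I J hI hIJ ih =>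
          intro c hc hcJ
          obtain ⟨c', hc', rfl⟩ := exists_decode_eq hIJ.1.1
          have hmem := ih c' (hc'.trans_le (Nat.le_add_left _ _)) rfl
          refine (hiff c).2 (.inr ⟨hc, hcJ ▸ hIJ.2.1, c', ?_, ?_⟩)
          · obtain h | h := Nat.lt_or_ge c' c
            · exact .inl ⟨h, hmem⟩
            · exact .inr ⟨h, heq ▸ hmem⟩
          · rw [symmDiff_comm, hcJ]; exact hIJ.2.2
      · have := Finset.card_lt_card hlt
        exact .inr (by omega)

theorem holds_answerExpr (hm : IsCoded m n k d G S T A) (hρ : IsEnv ρ (n + 2 ^ A.card) n k d)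
    (hT : T ⊆ A)
    (hmark : ∀ c, c ∈ markSet m (n + 2 ^ A.card) n ↔
      c < n + 2 ^ A.card ∧ G.ReconfigReach k A S (decode A c)) :
    answerExpr.Holds m ρ ↔ G.ReconfigReach k A S T := by
  have hTn : T ⊆ Finset.range n := fun v hv => Finset.mem_range.2 (hm.mem_iff.1 (hT hv)).1
  have key : ∀ c < n + 2 ^ A.card, (conj (markExpr 10) (isSetExpr 10 (targetExpr 11))).Holds m
      (Function.update ρ 10 c) ↔ G.ReconfigReach k A S (decode A c) ∧ decode A c = T := by
    intro c hc
    have hρ' := hρ.update (x := 10) (i := c) (by simp)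
    rw [holds_conj, holds_markExpr hρ', Function.update_self, holds_isSetExpr hm hρ' (Nat.le_add_right _ _)
      (by simpa) (by simp) (by simp) hTn fun v hv => by
        rw [holds_targetExpr hm.isInput (hρ'.update (by simp)) (by simpa), Function.update_self],
      Function.update_self]
    refine and_congr_left fun _ => ?_
    have := hmark c
    rw [mem_markSet] at this
    simpa only [hc, true_and] using this
  rw [answerExpr, holds_sum, hρ.bound]
  constructor
  · rintro ⟨c, hc, h⟩
    obtain ⟨h, rfl⟩ := (key c hc).1 h
    exact h
  · intro h
    obtain ⟨c, hc, hcT⟩ := exists_decode_eq hT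
    have hc' := hc.trans_le (Nat.le_add_left _ n)
    exact ⟨c, hc', (key c hc').2 ⟨hcT ▸ h, hcT⟩⟩

end

end DegenerateISR

/-! ### The algorithm -/

namespace DegenerateISR

open SumExpr

/-- The length of the input, computed when variable `0` has the value `n`. -/
def lengthExpr : SumExpr := .add (.add (.add (.const 3) (.var 1)) (.var 1)) (.sum 5 (.var 1))

/-- The program that decides independent set reconfiguration. -/
def solver : RAMProgram :=
  -- Variable `0` is set to `n` first, since `lengthExpr` obtains `n * n` as a sum over its range.
  -- All variables are below 30, where the scratch registers begin.
  .seq (assign 0 (.load (.const 0)) 30) <|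
  .seq (assign 1 (.load (.const 0)) 30) <|
  .seq (assign 2 (.load (.const 1)) 30) <|
  .seq (assign 3 (.load (.const 2)) 30) <|
  .seq (assign 4 lengthExpr 30) <|
  .seq (kernelProgram.compile 30) <|
  .seq (weightProgram.compile 30) <|
  -- From here on loops run over `n + 2 ^ A.card` numbers.
  .seq (assign 0 boundExpr 30) <|
  .seq (searchProgram.compile 30) <|
  assign 0 answerExpr 30

/-- A bound on the time for each of the parts of the program. -/
def stageCost (B : ℕ) : ℕ :=
  lengthExpr.cost B + kernelProgram.cost B + weightProgram.cost B + boundExpr.cost B +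
    -- The `4` covers an assignment from a fixed address: two steps to load and two to copy.
    searchProgram.cost B + answerExpr.cost B + 4

theorem polyBounded_stageCost : PolyBounded stageCost :=
  ((((((polyBounded_cost _).add (LoopProgram.polyBounded_cost _)).add
    (LoopProgram.polyBounded_cost _)).add (polyBounded_cost _)).add
    (LoopProgram.polyBounded_cost _)).add (polyBounded_cost _)).add (.const 4)

theorem IsEnv.congr {ρ ρ' : ℕ → ℕ} {B n k d : ℕ} (h : IsEnv ρ B n k d)
    (h' : ∀ i < 30, ρ' i = ρ i) : IsEnv ρ' B n k d := by
  constructor <;> rw [h' _ (by simp)]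
  exacts [h.bound, h.n_eq, h.k_eq, h.d_eq, h.length_eq]

theorem IsEnv.update_bound {ρ ρ' : ℕ → ℕ} {B B' n k d : ℕ} (h : IsEnv ρ B n k d)
    (h' : ∀ i < 30, ρ' i = Function.update ρ 0 B' i) : IsEnv ρ' B' n k d := by
  constructor <;> rw [h' _ (by simp)]
  · simp
  all_goals rw [Function.update_of_ne (by simp)]
  exacts [h.n_eq, h.k_eq, h.d_eq, h.length_eq]

open Classical in
-- The ten stages run with loop bound `0`, then `n`, then `n + 2 ^ A.card`; the kernel bound makes
-- one `X` sufficient for all of them.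
theorem halts_solver {s : RAMState} {n k d : ℕ} {G : SimpleGraph ℕ} {S T : Finset ℕ}
    (hreg : ∀ i, s.reg i = 0) (hm : IsInput s.mem n k d G S T)
    (hdeg : ∀ S ⊆ Finset.range n, S.Nonempty → ∃ v ∈ S, (S.filter fun u => G.Adj u v).card ≤ d)
    (hSn : S ⊆ Finset.range n) (hTn : T ⊆ Finset.range n)
    (hSi : G.IsIndepSet (S : Set ℕ)) (hSk : S.card = k) (hTk : T.card = k) {X : ℕ}
    (hX : ∀ B ≤ n + 2 ^ SimpleGraph.kernelBound k d, stageCost B ≤ X) :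
    RAMHalts solver s (10 * X) fun s' =>
      s'.reg 0 ≠ 0 ↔ G.ReconfigReach k (Finset.range n) S T := by
  have hn := hX n (Nat.le_add_right _ _)
  have h0 := hX 0 (Nat.zero_le _)
  unfold stageCost at hn h0
  have hload : ∀ B c, cost B (.load (.const c)) = 2 := fun _ _ => rfl
  refine RAMHalts.mono (T := X + (X + (X + (X + (X + (X + (X + (X + (X + X)))))))))
    ?_ (by omega) fun _ h => h
  refine .seq ((halts_assign (N := 30) (by decide) (by decide) le_rfl s (hreg 0)).mono
    (by rw [hload]; omega) fun _ h => h) ?_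
  rintro s₁ ⟨hm₁, hreg₁⟩
  have hB₁ : s₁.reg 0 = n := by rw [hreg₁ 0 (by simp)]; simp [hm.n_eq]
  refine .seq ((halts_assign (N := 30) (by decide) (by decide) le_rfl s₁ hB₁).mono
    (by rw [hload]; omega) fun _ h => h) ?_
  rintro s₂ ⟨hm₂, hreg₂⟩
  have hB₂ : s₂.reg 0 = n := by rw [hreg₂ 0 (by simp)]; simp [hB₁]
  refine .seq ((halts_assign (N := 30) (by decide) (by decide) le_rfl s₂ hB₂).mono
    (by rw [hload]; omega) fun _ h => h) ?_
  rintro s₃ ⟨hm₃, hreg₃⟩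
  have hB₃ : s₃.reg 0 = n := by rw [hreg₃ 0 (by simp)]; simp [hB₂]
  refine .seq ((halts_assign (N := 30) (by decide) (by decide) le_rfl s₃ hB₃).mono
    (by rw [hload]; omega) fun _ h => h) ?_
  rintro s₄ ⟨hm₄, hreg₄⟩
  have hB₄ : s₄.reg 0 = n := by rw [hreg₄ 0 (by simp)]; simp [hB₃]
  refine .seq ((halts_assign (N := 30) (by decide) (by decide) le_rfl s₄ hB₄).mono
    (by omega) fun _ h => h) ?_
  rintro s₅ ⟨hm₅, hreg₅⟩
  have hmem : s₅.mem = s.mem := by rw [hm₅, hm₄, hm₃, hm₂, hm₁]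
  have hn₄ : s₄.reg 1 = n := by
    rw [hreg₄ 1 (by simp), Function.update_of_ne (by simp), hreg₃ 1 (by simp),
      Function.update_of_ne (by simp), hreg₂ 1 (by simp)]
    simp [hm₁, hm.n_eq]
  have hρ₅ : IsEnv s₅.reg n n k d := by
    constructor
    · rw [hreg₅ 0 (by simp)]; simp [hB₄]
    · rw [hreg₅ 1 (by simp)]; simp [hn₄]
    · rw [hreg₅ 2 (by simp), Function.update_of_ne (by simp), hreg₄ 2 (by simp),
        Function.update_of_ne (by simp), hreg₃ 2 (by simp)]
      simp [hm₂, hm₁, hm.k_eq]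
    · rw [hreg₅ 3 (by simp), Function.update_of_ne (by simp), hreg₄ 3 (by simp)]
      simp [hm₃, hm₂, hm₁, hm.d_eq]
    · rw [hreg₅ 4 (by simp)]
      simp [lengthExpr, eval_sum, hn₄, hB₄, inputLength]
  rw [← hmem] at hm
  obtain ⟨hred, hcard⟩ := kernelProgram_spec hm hρ₅ hdeg hSn hTn hSk hTk
  refine .seq ((LoopProgram.halts_compile (N := 30) (by decide) (by decide) le_rfl s₅
    hρ₅.bound).mono (by omega) fun _ h => h) ?_
  rintro s₆ ⟨hm₆, hreg₆⟩
  rw [← hm₆] at hred hcard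
  have hρ₆ := hρ₅.congr hreg₆
  have hcode := weightProgram_spec hred.isInput hρ₆
  set A := aliveSet s₆.mem n
  refine .seq ((LoopProgram.halts_compile (N := 30) (by decide) (by decide) le_rfl s₆
    hρ₆.bound).mono (by omega) fun _ h => h) ?_
  rintro s₇ ⟨hm₇, hreg₇⟩
  rw [← hm₇] at hcode
  have hρ₇ := hρ₆.congr hreg₇
  refine .seq ((halts_assign (N := 30) (by decide) (by decide) le_rfl s₇ hρ₇.bound).mono
    (by omega) fun _ h => h) ?_
  rintro s₈ ⟨hm₈, hreg₈⟩
  rw [eval_boundExpr hcode hρ₇] at hreg₈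
  have hρ₈ := hρ₇.update_bound hreg₈
  rw [← hm₈] at hcode
  have hN := hX (n + 2 ^ A.card)
    (Nat.add_le_add_left (Nat.pow_le_pow_right (by simp) hcard) n)
  unfold stageCost at hN
  obtain ⟨hcode', hmark⟩ := searchProgram_spec hcode hρ₈ ⟨hred.source_subset, hSi, .inl hSk⟩ rfl
  refine .seq ((LoopProgram.halts_compile (N := 30) (by decide) (by decide) le_rfl s₈
    hρ₈.bound).mono (by omega) fun _ h => h) ?_
  rintro s₉ ⟨hm₉, hreg₉⟩
  rw [← hm₉] at hcode' hmark
  have hρ₉ := hρ₈.congr hreg₉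
  refine (halts_assign (N := 30) (by decide) (by decide) le_rfl s₉ hρ₉.bound).mono
    (by omega) ?_
  rintro s' ⟨-, hreg'⟩
  rw [hreg' 0 (by simp), Function.update_self]
  refine (holds_answerExpr hcode' hρ₉ hred.target_subset hmark).trans
    ⟨fun h => h.mono fun v hv => Finset.mem_range.2 (lt_of_mem_aliveSet hv), hred.reach⟩

/-! ### Instances as graphs on the natural numbers -/

section Instance

variable (x : DegenerateISRInstance)

/-- The graph of an instance as a graph on the natural numbers. -/
def natGraph : SimpleGraph ℕ := x.graph.map Fin.val

theorem natGraph_adj {u v : Fin x.n} : (natGraph x).Adj u v ↔ x.graph.Adj u v :=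
  SimpleGraph.map_adj_apply (f := Fin.valEmbedding)

theorem natGraph_isIndepSet {I : Finset (Fin x.n)} :
    (natGraph x).IsIndepSet (I.image Fin.val : Finset ℕ) ↔ x.graph.IsIndepSet (I : Set (Fin x.n)) := by
  rw [Finset.coe_image, SimpleGraph.IsIndepSet, SimpleGraph.IsIndepSet,
    Fin.val_injective.injOn.pairwise_image]
  simp only [Set.Pairwise, Function.onFun, natGraph_adj]

theorem exists_image_val_eq {n : ℕ} {I : Finset ℕ} (h : I ⊆ Finset.range n) :
    ∃ J : Finset (Fin n), J.image Fin.val = I := by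
  refine ⟨Finset.univ.filter fun v => v.val ∈ I, ?_⟩
  ext v
  simp only [Finset.mem_image, Finset.mem_filter, Finset.mem_univ, true_and]
  constructor
  · rintro ⟨w, hw, rfl⟩
    exact hw
  · exact fun hv => ⟨⟨v, Finset.mem_range.1 (h hv)⟩, hv, rfl⟩

theorem image_val_subset {n : ℕ} (I : Finset (Fin n)) : I.image Fin.val ⊆ Finset.range n := by
  intro v hv
  obtain ⟨w, -, rfl⟩ := Finset.mem_image.1 hv
  simp

theorem mem_image_val_iff {n v : ℕ} (hv : v < n) {I : Finset (Fin n)} :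
    v ∈ I.image Fin.val ↔ ⟨v, hv⟩ ∈ I := by
  simp only [Finset.mem_image]
  exact ⟨fun ⟨w, hw, h⟩ => by subst h; exact hw, fun h => ⟨_, h, rfl⟩⟩

theorem isReconfigNode_image {I : Finset (Fin x.n)} :
    (natGraph x).IsReconfigNode x.k (Finset.range x.n) (I.image Fin.val) ↔
      x.graph.IsIndepSet (I : Set (Fin x.n)) ∧ (I.card = x.k ∨ I.card + 1 = x.k) := by
  rw [SimpleGraph.IsReconfigNode, and_iff_right (image_val_subset I), natGraph_isIndepSet,
    Finset.card_image_of_injective _ Fin.val_injective]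

/-- Steps correspond under the embedding of `Fin n` into `ℕ`, since injective images preserve
cardinalities and symmetric differences. -/
theorem isYes_iff : x.IsYes ↔ (natGraph x).ReconfigReach x.k (Finset.range x.n)
    (x.source.image Fin.val) (x.target.image Fin.val) := by
  rw [DegenerateISRInstance.IsYes, SimpleGraph.reachable_iff_reflTransGen]
  constructor
  · intro h
    refine Relation.ReflTransGen.lift (p := (natGraph x).ReconfigStep x.k (Finset.range x.n))
      (fun I : {I : Finset (Fin x.n) // x.graph.IsIndepSet (I : Set (Fin x.n)) ∧
        (I.card = x.k ∨ I.card + 1 = x.k)} => I.1.image Fin.val) (fun I J hIJ => ?_) _ _ h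
    refine ⟨(isReconfigNode_image x).2 I.2, (isReconfigNode_image x).2 J.2, ?_⟩
    rw [← Finset.image_symmDiff _ _ Fin.val_injective,
      Finset.card_image_of_injective _ Fin.val_injective]
    exact hIJ
  -- The induction runs over sets of natural numbers, so it quantifies over the nodes with a given
  -- image; intermediate sets lift because they lie in the range of `n`.
  · suffices H : ∀ J, (natGraph x).ReconfigReach x.k (Finset.range x.n)
        (x.source.image Fin.val) J → ∀ J', J = J'.1.image Fin.val →
        Relation.ReflTransGen (x.graph.isReconfigurationGraph x.k).Adj
          ⟨x.source, x.source_indep, Or.inl x.source_card⟩ J' from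
      fun h => H _ h ⟨x.target, x.target_indep, Or.inl x.target_card⟩ rfl
    intro J hJ
    induction hJ with
    | refl =>
      intro J' hJ'
      obtain rfl : J' = ⟨x.source, x.source_indep, Or.inl x.source_card⟩ :=
        Subtype.ext (Finset.image_injective Fin.val_injective hJ'.symm)
      exact .refl
    | @tail I J _ hIJ ih =>
      rintro J' rfl
      obtain ⟨I', rfl⟩ := exists_image_val_eq hIJ.1.1
      refine (ih ⟨I', (isReconfigNode_image x).1 hIJ.1⟩ rfl).tail ?_
      have := hIJ.2.2
      rw [← Finset.image_symmDiff _ _ Fin.val_injective,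
        Finset.card_image_of_injective _ Fin.val_injective] at this
      exact this

open Classical in
theorem natGraph_degenerate (S : Finset ℕ) (hS : S ⊆ Finset.range x.n) (hne : S.Nonempty) :
    ∃ v ∈ S, (S.filter fun u => (natGraph x).Adj u v).card ≤ x.d := by
  obtain ⟨S', rfl⟩ := exists_image_val_eq hS
  obtain ⟨v, hv⟩ := x.degenerate S' (by simpa using hne)
  refine ⟨v.1, Finset.mem_image_of_mem _ v.2, ?_⟩
  rw [← Nat.cast_le (α := ℕ∞), ← Set.encard_coe_eq_coe_finsetCard]
  refine le_trans ?_ hv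
  refine le_trans (Set.encard_le_encard ?_)
    (Set.encard_image_le (fun w : (S' : Set (Fin x.n)) => w.1.val) _)
  intro u hu
  obtain ⟨hu, huv⟩ := Finset.mem_filter.1 (Finset.mem_coe.1 hu)
  obtain ⟨w, hw, rfl⟩ := Finset.mem_image.1 hu
  exact ⟨⟨w, hw⟩, ((natGraph_adj x).1 huv).symm, rfl⟩

theorem isInput_init : IsInput (RAMState.init x.encode).mem x.n x.k x.d (natGraph x)
    (x.source.image Fin.val) (x.target.image Fin.val) := by
  classical
  have hmem : ∀ i, (RAMState.init x.encode).mem i = x.encode.getD i 0 := fun _ => rfl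
  refine ⟨rfl, rfl, rfl, fun v hv => ?_, fun v hv => ?_, fun u hu v hv => ?_⟩
  · rw [hmem, DegenerateISRInstance.encode, List.getD_append _ _ _ _ (by simp; omega),
      List.getD_append _ _ _ _ (by simp; omega), List.getD_append_right _ _ _ _ (by simp),
      List.getD_eq_getElem _ _ (by simpa using hv), List.getElem_ofFn, mem_image_val_iff hv]
    simp
  · rw [hmem, DegenerateISRInstance.encode, List.getD_append _ _ _ _ (by simp; omega),
      List.getD_append_right _ _ _ _ (by simp; omega),
      List.getD_eq_getElem _ _ (by simp; omega), List.getElem_ofFn, mem_image_val_iff hv,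
      ite_ne_right_iff, and_iff_left one_ne_zero]
    congr! 2
    simp; omega
  · have huv : u * x.n + v < x.n * x.n := by nlinarith
    rw [hmem, DegenerateISRInstance.encode, List.getD_append_right _ _ _ _ (by simp; omega),
      List.getD_eq_getElem _ _ (by simp; omega), List.getElem_ofFn,
      ite_ne_right_iff, and_iff_left one_ne_zero, ← natGraph_adj, Fin.coe_divNat, Fin.coe_modNat]
    have hidx : ∀ i, i = v + x.n * u → i / x.n = u ∧ i % x.n = v := by
      rintro i rfl
      rw [Nat.add_mul_div_left _ _ (by omega), Nat.add_mul_mod_self_left, Nat.div_eq_of_lt hv,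
        Nat.mod_eq_of_lt hv, zero_add]
      exact ⟨rfl, rfl⟩
    rw [(hidx _ _).1, (hidx _ _).2] <;> simp [mul_comm x.n u] <;> omega

theorem lt_inputSize : x.n + 1 ≤ inputSize x.encode := by
  have : (x.encode.map fun a => Nat.size a + 1).length ≤ inputSize x.encode :=
    List.length_le_sum_of_one_le _ (by simp)
  refine le_trans ?_ this
  simp [DegenerateISRInstance.encode]
  omega

end Instance

end DegenerateISR

/-! ### The time bound in terms of parameter and input size -/

theorem mainTheorem1 : degenerateISR.IsFPT := by
  obtain ⟨C, D, hCD⟩ := DegenerateISR.polyBounded_stageCost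
  let F : ℕ → ℕ → ℕ := fun k d => 10 * (C * (2 ^ SimpleGraph.kernelBound k d + 1) ^ D)
  refine ⟨DegenerateISR.solver,
    -- The parameter gives only `k + d`; summing over all pairs with entries at most `p` dominates
    -- the value at the actual pair.
    fun p => ∑ k ∈ Finset.range (p + 1), ∑ d ∈ Finset.range (p + 1), F k d, D, fun x => ?_⟩
  change DegenerateISRInstance at x
  have hsize := DegenerateISR.lt_inputSize x
  obtain ⟨t, s, hrun, ht, hs⟩ := DegenerateISR.halts_solver
    (X := C * (2 ^ SimpleGraph.kernelBound x.k x.d + 1) ^ D * inputSize x.encode ^ D)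
    (fun _ => rfl) (DegenerateISR.isInput_init x) (DegenerateISR.natGraph_degenerate x)
    (DegenerateISR.image_val_subset _) (DegenerateISR.image_val_subset _)
    ((DegenerateISR.natGraph_isIndepSet x).2 x.source_indep)
    (by rw [Finset.card_image_of_injective _ Fin.val_injective, x.source_card])
    (by rw [Finset.card_image_of_injective _ Fin.val_injective, x.target_card])
    (fun B hB => by
      refine (hCD B).trans ?_
      rw [mul_assoc, ← mul_pow]
      gcongr
      -- With K the kernel bound, n + 2^K + 1 ≤ (2^K + 1)(n + 1), and n + 1 is at most the input
      -- size.
      nlinarith [Nat.zero_le (2 ^ SimpleGraph.kernelBound x.k x.d)])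
  refine ⟨t, s, hrun, ht.trans ?_, hs.trans (DegenerateISR.isYes_iff x).symm⟩
  have h1 : F x.k x.d ≤ ∑ d ∈ Finset.range (x.k + x.d + 1), F x.k d :=
    Finset.single_le_sum (f := fun d => F x.k d) (fun _ _ => Nat.zero_le _)
      (Finset.mem_range.2 (by omega))
  have h2 : ∑ d ∈ Finset.range (x.k + x.d + 1), F x.k d ≤
      ∑ k ∈ Finset.range (x.k + x.d + 1), ∑ d ∈ Finset.range (x.k + x.d + 1), F k d :=
    Finset.single_le_sum (f := fun k => ∑ d ∈ Finset.range (x.k + x.d + 1), F k d)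
      (fun _ _ => Nat.zero_le _) (Finset.mem_range.2 (by omega))
  rw [← mul_assoc]
  exact Nat.mul_le_mul_right _ (h1.trans h2)
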